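/- Let $\mathcal B$ be a $d$-dimensional globally hyperbolic spacetime, i.e. a smooth (Hausdorff, second countable, not necessarily connected) manifold without boundary with a smooth Lorentzian metric and a time orientation, without closed causal curves and with compact causal diamonds $J^+(p)\cap J^-(q)$. For $S\subset\mathcal B$ let $J^{\pm}[S]$ be the causal future/past of $S$ (which contains $S$), and let $D[S]$ be the domain of dependence: the set of points $p\in\mathcal B$ such that every inextendible causal curve through $p$ intersects $S$. Let $\Sigma$ be an acausal Cauchy slice of $\mathcal B$: a closed set no two distinct points of which are connected by a causal curve, with $D[\Sigma]=\mathcal B$. Let $N\subset\Sigma$ be closed (for example a closed codimension-zero submanifold-with-boundary of $\Sigma$), and let $A$ be the interior of $N$ in $\Sigma$, $\partial A$ the boundary of $N$ in $\Sigma$ (for a closed codimension-zero submanifold-with-boundary these are its manifold interior and manifold boundary), and $A^c:=\Sigma\setminus(A\cup\partial A)$. Then \begin{align*} D[A]\cup D[A^c]\cup J^+[\partial A]\cup J^-[\partial A]&=\mathcal B,\\ D[A]\cap D[A^c]=D[A]\cap J^{\pm}[\partial A]=D[A^c]\cap J^{\pm}[\partial A]&=\emptyset,\\ J^+[\partial A]\cap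 J^-[\partial A]&=\partial A. \end{align*} -/

import Mathlib

open scoped Manifold ContDiff Topology

noncomputable section

/-- A smooth Lorentzian metric of signature `(-,+,…,+)` on a `d`-dimensional smooth manifold:
a smooth symmetric `(0,2)`-tensor field which, at each point, is negative on some tangent vector `v`
and positive definite on the orthogonal complement of `v`. -/
structure LorentzianMetric (d : ℕ) (B : Type*) [TopologicalSpace B]
    [ChartedSpace (EuclideanSpace ℝ (Fin d)) B] [IsManifold (𝓡 d) ∞ B] where
  /-- The bilinear form on each tangent space. -/
  inner (b : B) : TangentSpace (𝓡 d) b →L[ℝ] TangentSpace (𝓡 d) b →L[ℝ] ℝ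
  symm (b : B) (v w : TangentSpace (𝓡 d) b) : inner b v w = inner b w v
  lorentzian (b : B) : ∃ v : TangentSpace (𝓡 d) b, inner b v v < 0 ∧
    ∀ w : TangentSpace (𝓡 d) b, w ≠ 0 → inner b v w = 0 → 0 < inner b w w
  contMDiff : ContMDiff (𝓡 d)
    ((𝓡 d).prod 𝓘(ℝ, EuclideanSpace ℝ (Fin d) →L[ℝ] EuclideanSpace ℝ (Fin d) →L[ℝ] ℝ)) ∞
    (fun b ↦ Bundle.TotalSpace.mk'
      (EuclideanSpace ℝ (Fin d) →L[ℝ] EuclideanSpace ℝ (Fin d) →L[ℝ] ℝ)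
      (E := fun b ↦ TangentSpace (𝓡 d) b →L[ℝ] TangentSpace (𝓡 d) b →L[ℝ] ℝ)
      b (inner b))

/-- A spacetime structure on a manifold: a Lorentzian metric with a time orientation, the latter
given by a smooth timelike vector field that is declared to point to the future. -/
structure Spacetime (d : ℕ) (B : Type*) [TopologicalSpace B]
    [ChartedSpace (EuclideanSpace ℝ (Fin d)) B] [IsManifold (𝓡 d) ∞ B] where
  /-- The Lorentzian metric. -/
  metric : LorentzianMetric d B
  /-- The future-pointing timelike vector field. -/
  timeField (b : B) : TangentSpace (𝓡 d) b
  timelike (b : B) : metric.inner b (timeField b) (timeField b) < 0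
  contMDiff_timeField : ContMDiff (𝓡 d) (𝓡 d).tangent ∞
    (fun b ↦ (⟨b, timeField b⟩ : TangentBundle (𝓡 d) B))

namespace Spacetime

variable {d : ℕ} {B : Type*} [TopologicalSpace B]
  [ChartedSpace (EuclideanSpace ℝ (Fin d)) B] [IsManifold (𝓡 d) ∞ B] (g : Spacetime d B)

/-- A tangent vector is future-directed causal if it is nonzero, timelike or null, and lies in the
same half of the cone as the time orientation. -/
def IsFutureCausal (b : B) (v : TangentSpace (𝓡 d) b) : Prop :=
  v ≠ 0 ∧ g.metric.inner b v v ≤ 0 ∧ g.metric.inner b v (g.timeField b) < 0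

/-- `γ` is a future-directed causal `C^1` curve on the compact interval `[a, b]`, `a < b`
(one-sided derivatives at the end points). -/
def IsCausalArc (γ : ℝ → B) (a b : ℝ) : Prop :=
  a < b ∧ ContMDiffOn 𝓘(ℝ, ℝ) (𝓡 d) 1 γ (Set.Icc a b) ∧
    ∀ t ∈ Set.Icc a b,
      g.IsFutureCausal (γ t) (mfderivWithin 𝓘(ℝ, ℝ) (𝓡 d) γ (Set.Icc a b) t (1 : ℝ))

/-- `γ` is a future-directed piecewise `C^1` causal curve on the interval `s`: to the right and to
the left of every parameter value (as far as `s` extends there) `γ` is at first a causal `C^1` arc.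
By compactness there are finitely many break points in each compact subinterval of `s`. -/
def IsCausalCurve (γ : ℝ → B) (s : Set ℝ) : Prop :=
  s.OrdConnected ∧ ∀ t ∈ s,
    (∀ u ∈ s, t < u → ∃ c, t < c ∧ c ≤ u ∧ g.IsCausalArc γ t c) ∧
    (∀ u ∈ s, u < t → ∃ c, u ≤ c ∧ c < t ∧ g.IsCausalArc γ c t)

/-- A causal curve on `s` without future end point and without past end point. Here `x` is a future
end point if each neighbourhood of `x` contains `γ t` for all sufficiently late `t ∈ s`. -/
def IsInextendibleCausalCurve (γ : ℝ → B) (s : Set ℝ) : Prop :=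
  g.IsCausalCurve γ s ∧
    (¬ ∃ x : B, ∀ U ∈ 𝓝 x, ∃ t₀ ∈ s, ∀ t ∈ s, t₀ ≤ t → γ t ∈ U) ∧
    (¬ ∃ x : B, ∀ U ∈ 𝓝 x, ∃ t₀ ∈ s, ∀ t ∈ s, t ≤ t₀ → γ t ∈ U)

/-- There is a (nondegenerate) future-directed causal curve from `p` to `q`. -/
def CausallyPrecedes (p q : B) : Prop :=
  ∃ (γ : ℝ → B) (a b : ℝ), a < b ∧ g.IsCausalCurve γ (Set.Icc a b) ∧ γ a = p ∧ γ b = q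

/-- The causal future `J⁺[S]`; it contains `S`. -/
def causalFuture (S : Set B) : Set B :=
  {q | ∃ p ∈ S, p = q ∨ g.CausallyPrecedes p q}

/-- The causal past `J⁻[S]`; it contains `S`. -/
def causalPast (S : Set B) : Set B :=
  {q | ∃ p ∈ S, p = q ∨ g.CausallyPrecedes q p}

/-- The domain of dependence `D[S]`: the points through which every inextendible causal curve
meets `S`. -/
def domainOfDependence (S : Set B) : Set B :=
  {p | ∀ (γ : ℝ → B) (s : Set ℝ), g.IsInextendibleCausalCurve γ s → p ∈ γ '' s →
    (γ '' s ∩ S).Nonempty}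

/-- No two distinct points of `S` are connected by a causal curve. -/
def IsAcausal (S : Set B) : Prop :=
  ∀ p ∈ S, ∀ q ∈ S, p ≠ q → ¬ g.CausallyPrecedes p q

/-- Global hyperbolicity: there are no closed causal curves and all causal diamonds
`J⁺(p) ∩ J⁻(q)` are compact. -/
def IsGloballyHyperbolic : Prop :=
  (∀ p, ¬ g.CausallyPrecedes p p) ∧
    ∀ p q, IsCompact (g.causalFuture {p} ∩ g.causalPast {q})

/-- An (acausal) Cauchy slice: a closed acausal set whose domain of dependence is the whole
spacetime. -/
def IsCauchySlice (S : Set B) : Prop :=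
  IsClosed S ∧ g.IsAcausal S ∧ g.domainOfDependence S = Set.univ

end Spacetime

/-- The interior of `N ∩ S` in the subspace topology of `S`, as a subset of the ambient space. -/
def relInterior {B : Type*} [TopologicalSpace B] (S N : Set B) : Set B :=
  (Subtype.val : S → B) '' interior ((Subtype.val : S → B) ⁻¹' N)

/-- The boundary of `N ∩ S` in the subspace topology of `S`, as a subset of the ambient space. -/
def relBoundary {B : Type*} [TopologicalSpace B] (S N : Set B) : Set B :=
  (Subtype.val : S → B) '' frontier ((Subtype.val : S → B) ⁻¹' N)

end

/-!
Each flow line of the time field is, when maximal, an inextendible causal curve, so it meets the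
Cauchy slice `S` (as `D[S]` is everything), and by acausality it meets it exactly once. This gives a
projection of the spacetime onto `S` along the time field, and the theorem rests on two facts.

* A causal curve extends to an inextendible one by attaching flow lines at its two ends
  (`CausallyPrecedes.exists_inextendible`). So a point of `D[X]`, `X ⊆ S`, is not causally related to
  a point of `S` outside `X`: the extended curve would meet the acausal set `S` twice
  (`not_related_of_mem_domainOfDependence`). This gives the disjointness statements.
* The projection along the time field is continuous, in the form that the points projecting to a
  relatively open part of `S` form an open set (`IsCauchySlice.isOpen_flow_saturation`). Let `p` be
  causally related to no point of `∂A`, and suppose that `p` lies in neither `D[A]` nor `D[Aᶜ]`,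
  where `Aᶜ` is the rest of the slice. Then `p` is causally related to a point of `Aᶜ` and to a
  point of `A`. Along a causal curve from a point of `A` to `p` the projection never meets `∂A`,
  since a point of `∂A` on such a flow line would be causally related to `p` or to another point of
  `S`. By connectedness `p` projects into `A`, and likewise into `Aᶜ`, a contradiction
  (`IsCauchySlice.exists_flowsTo_of_related`).

The projection is handled through the relation `FlowsTo`, which says that two points lie on a common
integral curve. Continuity combines a continuous local flow from the Picard-Lindelöf theorem
(`exists_local_flow`) with the openness of the strict causal future and past of `S`. The latter comes
from the openness of the timelike cone in the tangent bundle: in a chart, a short segment pointing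
approximately along the time field is causal (`exists_chart_cone`).
-/

open scoped Manifold ContDiff Topology
open Set

/-! ### Causal curves -/

namespace Spacetime

variable {d : ℕ} {B : Type*} [TopologicalSpace B]
  [ChartedSpace (EuclideanSpace ℝ (Fin d)) B] [IsManifold (𝓡 d) ∞ B] {g : Spacetime d B}

theorem IsFutureCausal.congr {x y : B} {v w : EuclideanSpace ℝ (Fin d)}
    (h : g.IsFutureCausal x v) (hxy : x = y) (hvw : v = w) : g.IsFutureCausal y w := by
  subst hxy hvw
  exact h

theorem isCausalArc_of_hasMFDerivWithinAt {γ : ℝ → B} {a b : ℝ} (hab : a < b)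
    (hc : ContMDiffOn 𝓘(ℝ, ℝ) (𝓡 d) 1 γ (Icc a b))
    (h : ∀ t ∈ Icc a b, ∃ v : TangentSpace (𝓡 d) (γ t), g.IsFutureCausal (γ t) v ∧
      HasMFDerivWithinAt 𝓘(ℝ, ℝ) (𝓡 d) γ (Icc a b) t ((1 : ℝ →L[ℝ] ℝ).smulRight v)) :
    g.IsCausalArc γ a b := by
  refine ⟨hab, hc, fun t ht ↦ ?_⟩
  obtain ⟨v, hv, hd⟩ := h t ht
  rw [hd.mfderivWithin (uniqueMDiffOn_iff_uniqueDiffOn.2 (uniqueDiffOn_Icc hab) t ht)]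
  refine hv.congr rfl ?_
  exact (one_smul ℝ v).symm

theorem IsCausalArc.hasMFDerivWithinAt {γ : ℝ → B} {a b t : ℝ} (h : g.IsCausalArc γ a b)
    (ht : t ∈ Icc a b) : ∃ v : TangentSpace (𝓡 d) (γ t), g.IsFutureCausal (γ t) v ∧
      HasMFDerivWithinAt 𝓘(ℝ, ℝ) (𝓡 d) γ (Icc a b) t ((1 : ℝ →L[ℝ] ℝ).smulRight v) := by
  refine ⟨_, h.2.2 t ht, ?_⟩
  have hd := ((h.2.1 t ht).mdifferentiableWithinAt one_ne_zero).hasMFDerivWithinAt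
  have heq : (1 : ℝ →L[ℝ] ℝ).smulRight (mfderivWithin 𝓘(ℝ, ℝ) (𝓡 d) γ (Icc a b) t (1 : ℝ)) =
      mfderivWithin 𝓘(ℝ, ℝ) (𝓡 d) γ (Icc a b) t :=
    ContinuousLinearMap.ext_ring (one_smul ℝ _)
  rw [heq]
  exact hd

theorem IsCausalArc.mono {γ : ℝ → B} {a b a' b' : ℝ} (h : g.IsCausalArc γ a b) (ha : a ≤ a')
    (hab : a' < b') (hb : b' ≤ b) : g.IsCausalArc γ a' b' := by
  have hsub : Icc a' b' ⊆ Icc a b := Icc_subset_Icc ha hb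
  refine isCausalArc_of_hasMFDerivWithinAt hab (h.2.1.mono hsub) fun t ht ↦ ?_
  obtain ⟨v, hv, hd⟩ := h.hasMFDerivWithinAt (hsub ht)
  exact ⟨v, hv, hd.mono hsub⟩

theorem IsCausalArc.congr {γ γ' : ℝ → B} {a b : ℝ} (h : g.IsCausalArc γ a b)
    (heq : EqOn γ' γ (Icc a b)) : g.IsCausalArc γ' a b := by
  refine isCausalArc_of_hasMFDerivWithinAt h.1 (h.2.1.congr heq) fun t ht ↦ ?_
  obtain ⟨v, hv, hd⟩ := h.hasMFDerivWithinAt ht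
  exact ⟨v, hv.congr (heq ht).symm rfl, hd.congr_of_eventuallyEq
    (Filter.eventually_of_mem self_mem_nhdsWithin heq) (heq ht)⟩

theorem IsCausalArc.comp_add {γ : ℝ → B} {a b : ℝ} (h : g.IsCausalArc γ a b) (c : ℝ) :
    g.IsCausalArc (fun t ↦ γ (t + c)) (a - c) (b - c) := by
  have hmaps : MapsTo (fun t : ℝ ↦ t + c) (Icc (a - c) (b - c)) (Icc a b) := fun t ht ↦
    ⟨by linarith [ht.1], by linarith [ht.2]⟩
  refine isCausalArc_of_hasMFDerivWithinAt (by linarith [h.1])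
    (h.2.1.comp (ContDiff.contMDiff (by fun_prop)).contMDiffOn hmaps) fun t ht ↦ ?_
  obtain ⟨v, hv, hd⟩ := h.hasMFDerivWithinAt (hmaps ht)
  refine ⟨v, hv, ?_⟩
  have hadd : HasMFDerivWithinAt 𝓘(ℝ, ℝ) 𝓘(ℝ, ℝ) (fun t : ℝ ↦ t + c) (Icc (a - c) (b - c)) t
      (ContinuousLinearMap.id ℝ ℝ) :=
    ((hasFDerivAt_id t).add_const c).hasFDerivWithinAt.hasMFDerivWithinAt
  exact HasMFDerivWithinAt.comp (u := Icc a b) t hd hadd fun u hu ↦ hmaps hu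

theorem IsCausalCurve.mono {γ : ℝ → B} {s s' : Set ℝ} (h : g.IsCausalCurve γ s) (hs : s' ⊆ s)
    (hs' : s'.OrdConnected) : g.IsCausalCurve γ s' :=
  ⟨hs', fun t ht ↦ ⟨fun u hu ↦ (h.2 t (hs ht)).1 u (hs hu), fun u hu ↦ (h.2 t (hs ht)).2 u (hs hu)⟩⟩

theorem IsCausalCurve.congr {γ γ' : ℝ → B} {s : Set ℝ} (h : g.IsCausalCurve γ s)
    (heq : EqOn γ' γ s) : g.IsCausalCurve γ' s := by
  refine ⟨h.1, fun t ht ↦ ⟨fun u hu htu ↦ ?_, fun u hu htu ↦ ?_⟩⟩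
  · obtain ⟨c, h1, h2, h3⟩ := (h.2 t ht).1 u hu htu
    exact ⟨c, h1, h2, h3.congr (heq.mono ((Icc_subset_Icc_right h2).trans (h.1.out ht hu)))⟩
  · obtain ⟨c, h1, h2, h3⟩ := (h.2 t ht).2 u hu htu
    exact ⟨c, h1, h2, h3.congr (heq.mono ((Icc_subset_Icc_left h1).trans (h.1.out hu ht)))⟩

theorem IsCausalCurve.comp_add {γ : ℝ → B} {s : Set ℝ} (h : g.IsCausalCurve γ s) (c : ℝ) :
    g.IsCausalCurve (fun t ↦ γ (t + c)) ((fun t ↦ t + c) ⁻¹' s) := by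
  refine ⟨⟨fun x hx y hy z hz ↦ h.1.out hx hy ⟨by linarith [hz.1], by linarith [hz.2]⟩⟩,
    fun t ht ↦ ⟨fun u hu htu ↦ ?_, fun u hu htu ↦ ?_⟩⟩
  · obtain ⟨e, h1, h2, h3⟩ := (h.2 (t + c) ht).1 (u + c) hu (by linarith)
    refine ⟨e - c, by linarith, by linarith, ?_⟩
    simpa using h3.comp_add c
  · obtain ⟨e, h1, h2, h3⟩ := (h.2 (t + c) ht).2 (u + c) hu (by linarith)
    refine ⟨e - c, by linarith, by linarith, ?_⟩
    simpa using h3.comp_add c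

/-- Causal curves can be concatenated: the definition of a causal curve only asks for `C^1` arcs on
either side of each parameter value, so a corner at the common end point is allowed. -/
theorem IsCausalCurve.union {γ : ℝ → B} {s s' : Set ℝ} {c : ℝ} (h : g.IsCausalCurve γ s)
    (h' : g.IsCausalCurve γ s') (hc : IsGreatest s c) (hc' : IsLeast s' c) :
    g.IsCausalCurve γ (s ∪ s') := by
  have hord : (s ∪ s').OrdConnected := by
    refine ⟨?_⟩
    rintro x (hx | hx) y (hy | hy) z hz
    · exact Or.inl (h.1.out hx hy hz)
    · rcases le_total z c with hzc | hzc
      · exact Or.inl (h.1.out hx hc.1 ⟨hz.1, hzc⟩)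
      · exact Or.inr (h'.1.out hc'.1 hy ⟨hzc, hz.2⟩)
    · obtain rfl : z = c := le_antisymm (hz.2.trans (hc.2 hy)) ((hc'.2 hx).trans hz.1)
      exact Or.inl hc.1
    · exact Or.inr (h'.1.out hx hy hz)
  refine ⟨hord, ?_⟩
  rintro t (ht | ht)
  · refine ⟨?_, ?_⟩
    · rintro u (hu | hu) htu
      · exact (h.2 t ht).1 u hu htu
      · rcases (hc.2 ht).lt_or_eq with htc | rfl
        · obtain ⟨e, h1, h2, h3⟩ := (h.2 t ht).1 c hc.1 htc
          exact ⟨e, h1, h2.trans (hc'.2 hu), h3⟩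
        · exact (h'.2 t hc'.1).1 u hu htu
    · rintro u (hu | hu) htu
      · exact (h.2 t ht).2 u hu htu
      · exact absurd (htu.trans_le (hc.2 ht)) (hc'.2 hu).not_gt
  · refine ⟨?_, ?_⟩
    · rintro u (hu | hu) htu
      · exact absurd ((hc'.2 ht).trans_lt htu) (hc.2 hu).not_gt
      · exact (h'.2 t ht).1 u hu htu
    · rintro u (hu | hu) htu
      · rcases (hc'.2 ht).lt_or_eq with htc | rfl
        · obtain ⟨e, h1, h2, h3⟩ := (h'.2 t ht).2 c hc'.1 htc
          exact ⟨e, (hc.2 hu).trans h1, h2, h3⟩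
        · exact (h.2 c hc.1).2 u hu htu
      · exact (h'.2 t ht).2 u hu htu

theorem IsCausalCurve.continuousOn {γ : ℝ → B} {s : Set ℝ} (h : g.IsCausalCurve γ s) :
    ContinuousOn γ s := by
  intro t ht
  -- one-sided continuity comes from the `C^1` arcs to the right and to the left of `t`
  have hr : ContinuousWithinAt γ (s ∩ Ici t) t := by
    by_cases hu : ∃ u ∈ s, t < u
    · obtain ⟨u, hu, htu⟩ := hu
      obtain ⟨c, h1, -, h3⟩ := (h.2 t ht).1 u hu htu
      refine (h3.2.1.continuousOn t (left_mem_Icc.2 h1.le)).mono_of_mem_nhdsWithin ?_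
      refine nhdsWithin_mono t inter_subset_right ?_
      exact Icc_mem_nhdsGE h1
    · push Not at hu
      refine continuousWithinAt_singleton.mono fun u hus ↦ ?_
      exact le_antisymm (hu u hus.1) hus.2
  have hl : ContinuousWithinAt γ (s ∩ Iic t) t := by
    by_cases hu : ∃ u ∈ s, u < t
    · obtain ⟨u, hu, htu⟩ := hu
      obtain ⟨c, -, h1, h3⟩ := (h.2 t ht).2 u hu htu
      refine (h3.2.1.continuousOn t (right_mem_Icc.2 h1.le)).mono_of_mem_nhdsWithin ?_
      refine nhdsWithin_mono t inter_subset_right ?_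
      exact Icc_mem_nhdsLE h1
    · push Not at hu
      refine continuousWithinAt_singleton.mono fun u hus ↦ ?_
      exact le_antisymm hus.2 (hu u hus.1)
  refine (hl.union hr).mono fun u hu ↦ ?_
  rcases le_total u t with hut | hut
  · exact Or.inl ⟨hu, hut⟩
  · exact Or.inr ⟨hu, hut⟩

theorem IsCausalCurve.causallyPrecedes {γ : ℝ → B} {s : Set ℝ} {t u : ℝ} (h : g.IsCausalCurve γ s)
    (ht : t ∈ s) (hu : u ∈ s) (htu : t < u) : g.CausallyPrecedes (γ t) (γ u) :=
  ⟨γ, t, u, htu, h.mono (h.1.out ht hu) ordConnected_Icc, rfl, rfl⟩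

theorem IsCausalCurve.piecewise {γ γ' : ℝ → B} {s s' : Set ℝ} {c : ℝ} (h : g.IsCausalCurve γ s)
    (h' : g.IsCausalCurve γ' s') (hc : IsGreatest s c) (hc' : IsLeast s' c) (heq : γ c = γ' c) :
    g.IsCausalCurve ((Iic c).piecewise γ γ') (s ∪ s') := by
  refine IsCausalCurve.union (h.congr fun t ht ↦ piecewise_eq_of_mem _ _ _ (hc.2 ht))
    (h'.congr fun t ht ↦ ?_) hc hc'
  rcases (hc'.2 ht).lt_or_eq with htc | rfl
  · exact piecewise_eq_of_notMem _ _ _ (by simpa using htc)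
  · rw [piecewise_eq_of_mem _ _ _ self_mem_Iic, heq]

theorem CausallyPrecedes.trans {p q r : B} (h : g.CausallyPrecedes p q)
    (h' : g.CausallyPrecedes q r) : g.CausallyPrecedes p r := by
  obtain ⟨γ, a, b, hab, hγ, rfl, rfl⟩ := h
  obtain ⟨δ, a', b', hab', hδ, hq, rfl⟩ := h'
  have hδ' := hδ.comp_add (a' - b)
  have hb : IsLeast ((fun t ↦ t + (a' - b)) ⁻¹' Icc a' b') b := by
    refine ⟨⟨by linarith, by linarith⟩, fun t ht ↦ by linarith [ht.1]⟩
  have hcurve := hγ.piecewise hδ' (isGreatest_Icc hab.le) hb (by simp [hq])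
  have := hcurve.causallyPrecedes (t := a) (u := b + (b' - a'))
    (Or.inl (left_mem_Icc.2 hab.le)) (Or.inr ⟨by linarith, by linarith⟩) (by linarith)
  rwa [piecewise_eq_of_mem _ _ _ (show a ∈ Iic b from hab.le),
    piecewise_eq_of_notMem _ _ _ (by simpa using hab'),
    show b + (b' - a') + (a' - b) = b' by ring] at this

end Spacetime

/-! ### Integral curves and local flows of vector fields -/

section Flow

variable {E : Type*} [NormedAddCommGroup E] [NormedSpace ℝ E]
  {H : Type*} [TopologicalSpace H] {I : ModelWithCorners ℝ E H}
  {M : Type*} [TopologicalSpace M] [ChartedSpace H M]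
  {v : (x : M) → TangentSpace I x}

/-- The point `y` is reached from `x` after time `t` (of any sign) along an integral curve of the
vector field `v`. The curve lives on an open interval containing `0` and `t`. -/
def FlowsTo (v : (x : M) → TangentSpace I x) (x : M) (t : ℝ) (y : M) : Prop :=
  ∃ (a b : ℝ) (γ : ℝ → M), (0 : ℝ) ∈ Ioo a b ∧ t ∈ Ioo a b ∧ IsMIntegralCurveOn γ v (Ioo a b) ∧
    γ 0 = x ∧ γ t = y

theorem IsMIntegralCurveOn.flowsTo {γ : ℝ → M} {a b t u : ℝ}
    (h : IsMIntegralCurveOn γ v (Ioo a b)) (ht : t ∈ Ioo a b) (hu : u ∈ Ioo a b) :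
    FlowsTo v (γ t) (u - t) (γ u) := by
  refine ⟨a - t, b - t, γ ∘ (· + t), ⟨by linarith [ht.1], by linarith [ht.2]⟩,
    ⟨by linarith [hu.1], by linarith [hu.2]⟩, ?_, by simp, by simp⟩
  refine (h.comp_add t).mono fun w hw ↦ ?_
  exact ⟨by linarith [hw.1], by linarith [hw.2]⟩

theorem FlowsTo.symm {x y : M} {t : ℝ} (h : FlowsTo v x t y) : FlowsTo v y (-t) x := by
  obtain ⟨a, b, γ, h0, ht, hγ, rfl, rfl⟩ := h
  simpa using hγ.flowsTo ht h0

theorem FlowsTo.eq_of_time_zero {x y : M} (h : FlowsTo v x 0 y) : x = y := by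
  obtain ⟨a, b, γ, -, -, -, rfl, rfl⟩ := h
  rfl

section Unique

variable [IsManifold I 1 M] [T2Space M] [BoundarylessManifold I M]

theorem FlowsTo.unique (hv : ContMDiff I I.tangent 1 (fun x ↦ (⟨x, v x⟩ : TangentBundle I M)))
    {x y y' : M} {t : ℝ} (h : FlowsTo v x t y) (h' : FlowsTo v x t y') : y = y' := by
  obtain ⟨a, b, γ, h0, ht, hγ, rfl, rfl⟩ := h
  obtain ⟨a', b', γ', h0', ht', hγ', h1, rfl⟩ := h'
  have hsub : Ioo (max a a') (min b b') = Ioo a b ∩ Ioo a' b' := Ioo_inter_Ioo.symm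
  refine isMIntegralCurveOn_Ioo_eqOn_of_contMDiff_boundaryless (a := max a a') (b := min b b')
    (t₀ := 0) ?_ hv (hγ.mono ?_) (hγ'.mono ?_) h1.symm ?_
  · exact hsub ▸ ⟨h0, h0'⟩
  · exact hsub ▸ inter_subset_left
  · exact hsub ▸ inter_subset_right
  · exact hsub ▸ ⟨ht, ht'⟩

theorem FlowsTo.trans (hv : ContMDiff I I.tangent 1 (fun x ↦ (⟨x, v x⟩ : TangentBundle I M)))
    {x y z : M} {t u : ℝ} (h : FlowsTo v x t y) (h' : FlowsTo v y u z) :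
    FlowsTo v x (t + u) z := by
  obtain ⟨a, b, γ, h0, ht, hγ, rfl, rfl⟩ := h
  obtain ⟨a', b', γ', h0', ht', hγ', h1, rfl⟩ := h'
  have hδ : IsMIntegralCurveOn (γ' ∘ (· + -t)) v (Ioo (a' + t) (b' + t)) :=
    (hγ'.comp_add (-t)).mono fun w hw ↦ ⟨by linarith [hw.1], by linarith [hw.2]⟩
  have ht1 : t ∈ Ioo a b ∩ Ioo (a' + t) (b' + t) :=
    ⟨ht, by linarith [h0'.1], by linarith [h0'.2]⟩
  have heq : γ t = (γ' ∘ (· + -t)) t := by simp [h1]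
  have hglue := isMIntegralCurveOn_piecewise hv hγ hδ ht1 heq
  have hright := eqOn_piecewise_of_isMIntegralCurveOn_Ioo hv hγ hδ ht1 heq
  have hunion : Ioo a b ∪ Ioo (a' + t) (b' + t) = Ioo (min a (a' + t)) (max b (b' + t)) :=
    Ioo_union_Ioo' (ht1.2.1.trans ht1.1.2) (ht1.1.1.trans ht1.2.2)
  have htu : t + u ∈ Ioo (a' + t) (b' + t) := ⟨by linarith [ht'.1], by linarith [ht'.2]⟩
  refine ⟨min a (a' + t), max b (b' + t), (Ioo a b).piecewise γ (γ' ∘ (· + -t)),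
    hunion ▸ Or.inl h0, hunion ▸ Or.inr htu, hunion ▸ hglue, piecewise_eq_of_mem _ _ _ h0, ?_⟩
  rw [hright htu]
  simp

end Unique

section Local

variable [IsManifold I 1 M]

/-- A solution of the ODE read in the chart at `x₀` is an integral curve on the manifold. -/
theorem hasMFDerivAt_extChartAt_symm_comp {x₀ : M} {f : ℝ → E} {t : ℝ}
    (hf : f t ∈ interior (extChartAt I x₀).target)
    (h : HasDerivAt f (tangentCoordChange I ((extChartAt I x₀).symm (f t)) x₀
      ((extChartAt I x₀).symm (f t)) (v ((extChartAt I x₀).symm (f t)))) t) :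
    HasMFDerivAt 𝓘(ℝ, ℝ) I ((extChartAt I x₀).symm ∘ f) t
      ((1 : ℝ →L[ℝ] ℝ).smulRight (v ((extChartAt I x₀).symm (f t)))) := by
  set xₜ : M := (extChartAt I x₀).symm (f t) with hxt
  have hf3' := interior_subset hf
  have hft1 := mem_preimage.mp <|
    mem_of_mem_of_subset hf3' (extChartAt I x₀).target_subset_preimage_source
  have hft2 := mem_extChartAt_source (I := I) xₜ
  have key : HasDerivAt ((extChartAt I xₜ ∘ (extChartAt I x₀).symm) ∘ f) (v xₜ : E) t := by
    have heq : tangentCoordChange I x₀ xₜ xₜ (tangentCoordChange I xₜ x₀ xₜ (v xₜ)) = v xₜ :=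
      (tangentCoordChange_comp ⟨⟨hft2, hft1⟩, hft2⟩).trans (tangentCoordChange_self hft2)
    refine HasDerivAt.congr_deriv (HasFDerivAt.comp_hasDerivAt _ ?_ h) heq
    apply HasFDerivWithinAt.hasFDerivAt (s := range I) _ <|
      mem_nhds_iff.mpr ⟨interior (extChartAt I x₀).target,
        subset_trans interior_subset (extChartAt_target_subset_range ..),
        isOpen_interior, hf⟩
    rw [← (extChartAt I x₀).right_inv hf3']
    exact hasFDerivWithinAt_tangentCoordChange ⟨hft1, hft2⟩
  have hfd : HasFDerivAt ((extChartAt I xₜ ∘ (extChartAt I x₀).symm) ∘ f)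
      ((1 : ℝ →L[ℝ] ℝ).smulRight (v xₜ : E)) t := by
    convert! key.hasFDerivAt using 1
  refine ⟨(continuousAt_extChartAt_symm'' hf3').comp h.continuousAt, ?_⟩
  simp only [mfld_simps]
  exact hfd.hasFDerivWithinAt

variable [CompleteSpace E]

/-- A `C^1` vector field has a continuous local flow near every interior point. -/
theorem exists_local_flow {x₀ : M}
    (hv : ContMDiffAt I I.tangent 1 (fun x ↦ (⟨x, v x⟩ : TangentBundle I M)) x₀)
    (hx : I.IsInteriorPoint x₀) :
    ∃ U ∈ 𝓝 x₀, ∃ ε > (0 : ℝ), ∃ φ : M × ℝ → M, ContinuousOn φ (U ×ˢ Ioo (-ε) ε) ∧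
      ∀ x ∈ U, ∀ t ∈ Ioo (-ε) ε, FlowsTo v x t (φ (x, t)) := by
  rw [contMDiffAt_iff] at hv
  obtain ⟨_, hv⟩ := hv
  obtain ⟨ε, hε, a, r, L, K, hr, hpl⟩ := IsPicardLindelof.of_contDiffAt_one
    (hv.contDiffAt (range_mem_nhds_isInteriorPoint hx)).snd
  obtain ⟨α, hα, hcont⟩ := (hpl 0).exists_forall_mem_closedBall_eq_hasDerivWithinAt_continuousOn
  set z₀ := extChartAt I x₀ x₀ with hz₀
  have hz₀t : z₀ ∈ interior (extChartAt I x₀).target := (I.isInteriorPoint_iff).mp hx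
  have hr' : (0 : ℝ) < r := hr
  -- shrink the domain so that the flow stays in the interior of the chart target
  have hnhds : α ⁻¹' interior (extChartAt I x₀).target ∈ 𝓝 (z₀, (0 : ℝ)) := by
    have hat : ContinuousAt α (z₀, (0 : ℝ)) := hcont.continuousAt
      (prod_mem_nhds (Metric.closedBall_mem_nhds _ hr') (Icc_mem_nhds (by linarith) (by linarith)))
    refine hat.preimage_mem_nhds (isOpen_interior.mem_nhds ?_)
    rwa [(hα z₀ (Metric.mem_closedBall_self hr'.le)).1]
  obtain ⟨ρ, hρ, hρsub⟩ := Metric.mem_nhds_iff.1 hnhds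
  set η := min ρ ε with hη
  have hη0 : 0 < η := lt_min hρ hε
  have htgt : ∀ z ∈ Metric.ball z₀ ρ, ∀ t ∈ Ioo (-η) η,
      α (z, t) ∈ interior (extChartAt I x₀).target := by
    intro z hz t ht
    apply hρsub
    rw [← ball_prod_same]
    refine ⟨hz, ?_⟩
    rw [Real.ball_eq_Ioo]
    exact ⟨by linarith [ht.1, min_le_left ρ ε], by linarith [ht.2, min_le_left ρ ε]⟩
  set U := (extChartAt I x₀).source ∩
    extChartAt I x₀ ⁻¹' (Metric.ball z₀ ρ ∩ Metric.closedBall z₀ r) with hU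
  have hUn : U ∈ 𝓝 x₀ := Filter.inter_mem (extChartAt_source_mem_nhds x₀)
    ((continuousAt_extChartAt x₀).preimage_mem_nhds
      (Filter.inter_mem (Metric.ball_mem_nhds _ hρ) (Metric.closedBall_mem_nhds _ hr')))
  refine ⟨U, hUn, η, hη0, fun p ↦ (extChartAt I x₀).symm (α (extChartAt I x₀ p.1, p.2)), ?_, ?_⟩
  · refine (continuousOn_extChartAt_symm x₀).comp (t := (extChartAt I x₀).target)
      (hcont.comp (t := Metric.closedBall z₀ r ×ˢ Icc (0 - ε) (0 + ε)) ?_ ?_) ?_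
    · exact ((continuousOn_extChartAt x₀).comp continuousOn_fst fun p hp ↦ hp.1.1).prodMk
        continuousOn_snd
    · rintro ⟨x, t⟩ ⟨hx, ht⟩
      exact ⟨hx.2.2, by linarith [ht.1, min_le_right ρ ε], by linarith [ht.2, min_le_right ρ ε]⟩
    · rintro ⟨x, t⟩ ⟨hx, ht⟩
      exact interior_subset (htgt _ hx.2.1 t ht)
  · intro x hx t ht
    refine ⟨-η, η, (extChartAt I x₀).symm ∘ fun t ↦ α (extChartAt I x₀ x, t), ⟨by linarith, hη0⟩,
      ht, ?_, ?_, rfl⟩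
    · intro u hu
      refine HasMFDerivAt.hasMFDerivWithinAt (hasMFDerivAt_extChartAt_symm_comp
        (htgt _ hx.2.1 u hu) ?_)
      have hlt1 : 0 - ε < u := by linarith [hu.1, min_le_right ρ ε]
      have hlt2 : u < 0 + ε := by linarith [hu.2, min_le_right ρ ε]
      exact ((hα _ hx.2.2).2 u ⟨hlt1.le, hlt2.le⟩).hasDerivAt (Icc_mem_nhds hlt1 hlt2)
    · change (extChartAt I x₀).symm (α (extChartAt I x₀ x, 0)) = x
      rw [(hα _ hx.2.2).1, (extChartAt I x₀).left_inv hx.1]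

end Local

section Maximal

variable [IsManifold I 1 M] [BoundarylessManifold I M] [CompleteSpace E]

theorem FlowsTo.refl (hv : ContMDiff I I.tangent 1 (fun x ↦ (⟨x, v x⟩ : TangentBundle I M)))
    (x : M) : FlowsTo v x 0 x := by
  obtain ⟨U, hU, ε, hε, φ, -, hφ⟩ :=
    exists_local_flow hv.contMDiffAt (BoundarylessManifold.isInteriorPoint (I := I) (x := x))
  obtain ⟨a, b, γ, h0, ht, hγ, h1, -⟩ := hφ x (mem_of_mem_nhds hU) 0 ⟨by linarith, hε⟩
  exact ⟨a, b, γ, h0, ht, hγ, h1, h1⟩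

variable [T2Space M]

/-- The maximal integral curve through `x`: it is defined at all times which are reached from `x`
by some integral curve. -/
theorem exists_maximal_integralCurve
    (hv : ContMDiff I I.tangent 1 (fun x ↦ (⟨x, v x⟩ : TangentBundle I M))) (x : M) :
    ∃ (γ : ℝ → M) (s : Set ℝ), IsOpen s ∧ s.OrdConnected ∧ (0 : ℝ) ∈ s ∧ γ 0 = x ∧
      IsMIntegralCurveOn γ v s ∧ (∀ t ∈ s, FlowsTo v x t (γ t)) ∧
      ∀ t y, FlowsTo v x t y → t ∈ s := by
  classical
  set s : Set ℝ := {t | ∃ y, FlowsTo v x t y} with hs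
  set γ : ℝ → M := fun t ↦ if h : ∃ y, FlowsTo v x t y then h.choose else x with hγdef
  have hγ : ∀ {t y}, FlowsTo v x t y → γ t = y := by
    intro t y h
    have hex : ∃ y, FlowsTo v x t y := ⟨y, h⟩
    simp only [hγdef, dif_pos hex]
    exact hex.choose_spec.unique hv h
  have hloc : ∀ t ∈ s, ∃ (a b : ℝ) (δ : ℝ → M), (0 : ℝ) ∈ Ioo a b ∧ t ∈ Ioo a b ∧
      Ioo a b ⊆ s ∧ IsMIntegralCurveOn δ v (Ioo a b) ∧ EqOn γ δ (Ioo a b) := by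
    rintro t ⟨y, a, b, δ, h0, ht, hδ, h1, rfl⟩
    have hflow : ∀ u ∈ Ioo a b, FlowsTo v x u (δ u) := fun u hu ↦ ⟨a, b, δ, h0, hu, hδ, h1, rfl⟩
    exact ⟨a, b, δ, h0, ht, fun u hu ↦ ⟨_, hflow u hu⟩, hδ, fun u hu ↦ hγ (hflow u hu)⟩
  have hopen : IsOpen s := isOpen_iff_mem_nhds.2 fun t ht ↦ by
    obtain ⟨a, b, δ, -, htab, hsub, -⟩ := hloc t ht
    exact Filter.mem_of_superset (Ioo_mem_nhds htab.1 htab.2) hsub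
  refine ⟨γ, s, hopen, ?_, ⟨x, FlowsTo.refl hv x⟩, hγ (FlowsTo.refl hv x), ?_, ?_,
    fun t y h ↦ ⟨y, h⟩⟩
  · refine (ordConnected_iff_uIcc_subset_left (show (0 : ℝ) ∈ s from ⟨x, FlowsTo.refl hv x⟩)).2 ?_
    intro t ht
    obtain ⟨a, b, δ, h0, htab, hsub, -⟩ := hloc t ht
    exact (ordConnected_Ioo.uIcc_subset h0 htab).trans hsub
  · refine IsMIntegralCurveAt.isMIntegralCurveOn fun t ht ↦ ?_
    obtain ⟨a, b, δ, -, htab, -, hδ, heq⟩ := hloc t ht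
    have hmem : Ioo a b ∈ 𝓝 t := Ioo_mem_nhds htab.1 htab.2
    refine isMIntegralCurveAt_iff.2 ⟨Ioo a b, hmem, fun u hu ↦ ?_⟩
    rw [heq hu]
    exact (hδ u hu).congr_of_eventuallyEq (Filter.eventually_of_mem self_mem_nhdsWithin heq)
      (heq hu)
  · rintro t ⟨y, h⟩
    rwa [hγ h]

/-- The set of points whose orbit meets `A` is open as soon as it is a neighbourhood of `A`: its
interior is invariant under the local flow, hence along every integral curve. -/
theorem isOpen_flow_saturation
    (hv : ContMDiff I I.tangent 1 (fun x ↦ (⟨x, v x⟩ : TangentBundle I M))) {A : Set M}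
    (hA : ∀ y ∈ A, ∀ᶠ x in 𝓝 y, ∃ t, ∃ z ∈ A, FlowsTo v x t z) :
    IsOpen {x | ∃ t, ∃ y ∈ A, FlowsTo v x t y} := by
  set W := {x | ∃ t, ∃ y ∈ A, FlowsTo v x t y} with hW
  rw [← interior_eq_iff_isOpen]
  refine interior_subset.antisymm ?_
  rintro x ⟨t, y, hy, a, b, γ, h0, ht, hγ, rfl, rfl⟩
  set u := Ioo a b ∩ γ ⁻¹' interior W with hu
  have huo : IsOpen u := hγ.continuousOn.isOpen_inter_preimage isOpen_Ioo isOpen_interior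
  have hne : (Ioo a b ∩ u).Nonempty := ⟨t, ht, ht, mem_interior_iff_mem_nhds.2 (hA _ hy)⟩
  -- the times at which `γ` is in `interior W` are shown to be relatively closed
  refine (isPreconnected_Ioo.subset_of_closure_inter_subset huo hne ?_ h0).2
  rintro τ ⟨hτu, hτ⟩
  refine ⟨hτ, ?_⟩
  obtain ⟨U, hU, ε, hε, φ, hφc, hφ⟩ :=
    exists_local_flow hv.contMDiffAt (BoundarylessManifold.isInteriorPoint (I := I) (x := γ τ))
  obtain ⟨σ, hσ, hσu⟩ := mem_closure_iff_nhds.1 hτu (Ioo (τ - ε) (τ + ε))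
    (Ioo_mem_nhds (by linarith) (by linarith))
  have hστ : σ - τ ∈ Ioo (-ε) ε := ⟨by linarith [hσ.1], by linarith [hσ.2]⟩
  have hflow : φ (γ τ, σ - τ) = γ σ :=
    (hφ _ (mem_of_mem_nhds hU) _ hστ).unique hv (hγ.flowsTo hτ hσu.1)
  have hcont : ContinuousAt (fun x ↦ φ (x, σ - τ)) (γ τ) :=
    ContinuousAt.comp (f := fun x ↦ (x, σ - τ)) (g := φ)
      (hφc.continuousAt (prod_mem_nhds hU (Ioo_mem_nhds hστ.1 hστ.2))) (by fun_prop)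
  rw [mem_preimage, mem_interior_iff_mem_nhds]
  have hpre : ∀ᶠ x in 𝓝 (γ τ), φ (x, σ - τ) ∈ interior W :=
    hcont.preimage_mem_nhds (by rw [hflow]; exact isOpen_interior.mem_nhds hσu.2)
  filter_upwards [hpre, hU] with x hx hxU
  obtain ⟨w, y, hy, h⟩ := interior_subset hx
  exact ⟨_, y, hy, (hφ x hxU _ hστ).trans hv h⟩

end Maximal

end Flow

/-! ### Flow lines of the time field -/

section Regularity

variable {E : Type*} [NormedAddCommGroup E] [NormedSpace ℝ E]
  {H : Type*} [TopologicalSpace H] {I : ModelWithCorners ℝ E H}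
  {M : Type*} [TopologicalSpace M] [ChartedSpace H M] [IsManifold I 1 M]
  {v : (x : M) → TangentSpace I x}

/-- Integral curves are `C^1`: in a chart the derivative is the fibre coordinate of the vector field
along the curve, which is continuous. -/
theorem IsMIntegralCurveAt.contMDiffAt {γ : ℝ → M} {t₀ : ℝ}
    (hv : Continuous (fun x ↦ (⟨x, v x⟩ : TangentBundle I M))) (hγ : IsMIntegralCurveAt γ v t₀) :
    ContMDiffAt 𝓘(ℝ, ℝ) I 1 γ t₀ := by
  rw [contMDiffAt_iff]
  refine ⟨hγ.continuousAt, ?_⟩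
  simp only [mfld_simps, contDiffWithinAt_univ]
  have hsrc : ∀ᶠ t in 𝓝 t₀, γ t ∈ (chartAt H (γ t₀)).source :=
    hγ.continuousAt.preimage_mem_nhds (chart_source_mem_nhds H (γ t₀))
  have hcont : ∀ᶠ t in 𝓝 t₀, ContinuousAt γ t := hγ.mono fun t ht ↦ ht.continuousAt
  obtain ⟨u, hu, hut⟩ := ((hγ.eventually_hasDerivAt).and (hsrc.and hcont)).exists_mem
  rw [contDiffAt_one_iff]
  refine ⟨fun t ↦ (1 : ℝ →L[ℝ] ℝ).smulRight
    ((trivializationAt E (TangentSpace I) (γ t₀) ⟨γ t, v (γ t)⟩).2 : E), u, hu, ?_, fun t ht ↦ ?_⟩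
  · intro t ht
    have h1 : ContinuousAt (fun t ↦ (⟨γ t, v (γ t)⟩ : TangentBundle I M)) t :=
      hv.continuousAt.comp (hut t ht).2.2
    have h2 : ContinuousAt (trivializationAt E (TangentSpace I) (γ t₀)) ⟨γ t, v (γ t)⟩ := by
      refine (trivializationAt E (TangentSpace I) (γ t₀)).continuousOn.continuousAt
        ((trivializationAt E (TangentSpace I) (γ t₀)).open_source.mem_nhds ?_)
      rw [Bundle.Trivialization.mem_source, TangentBundle.trivializationAt_baseSet]
      exact (hut t ht).2.1
    have h3 : ContinuousAt
        (fun t ↦ (trivializationAt E (TangentSpace I) (γ t₀) ⟨γ t, v (γ t)⟩).2) t :=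
      continuous_snd.continuousAt.comp (ContinuousAt.comp
        (f := fun t ↦ (⟨γ t, v (γ t)⟩ : TangentBundle I M)) (x := t) h2 h1)
    exact ((ContinuousLinearMap.smulRightL ℝ ℝ E 1).continuous.continuousAt.comp
      h3).continuousWithinAt
  · exact (hut t ht).1.hasFDerivAt

end Regularity

namespace Spacetime

variable {d : ℕ} {B : Type*} [TopologicalSpace B]
  [ChartedSpace (EuclideanSpace ℝ (Fin d)) B] [IsManifold (𝓡 d) ∞ B] {g : Spacetime d B}

variable (g) in
theorem isFutureCausal_timeField (b : B) : g.IsFutureCausal b (g.timeField b) := by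
  refine ⟨fun h ↦ ?_, (g.timelike b).le, g.timelike b⟩
  have := g.timelike b
  simp [h] at this

variable (g) in
theorem contMDiff_one_timeField : ContMDiff (𝓡 d) (𝓡 d).tangent 1
    (fun b ↦ (⟨b, g.timeField b⟩ : TangentBundle (𝓡 d) B)) :=
  g.contMDiff_timeField.of_le (by norm_cast)

theorem isCausalCurve_of_isMIntegralCurveOn {γ : ℝ → B} {s : Set ℝ} (hs : IsOpen s)
    (hs' : s.OrdConnected) (h : IsMIntegralCurveOn γ g.timeField s) : g.IsCausalCurve γ s := by
  have : IsManifold (𝓡 d) 1 B := .of_le (n := ∞) (by norm_cast)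
  have harc : ∀ a ∈ s, ∀ b ∈ s, a < b → g.IsCausalArc γ a b := by
    intro a ha b hb hab
    have hsub := hs'.out ha hb
    refine isCausalArc_of_hasMFDerivWithinAt hab (fun t ht ↦ ?_) fun t ht ↦
      ⟨_, g.isFutureCausal_timeField _, (h t (hsub ht)).mono hsub⟩
    exact (IsMIntegralCurveAt.contMDiffAt g.contMDiff_one_timeField.continuous
      (h.isMIntegralCurveAt (hs.mem_nhds (hsub ht)))).contMDiffWithinAt
  exact ⟨hs', fun t ht ↦ ⟨fun u hu htu ↦ ⟨u, htu, le_rfl, harc t ht u hu htu⟩,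
    fun u hu hut ↦ ⟨u, le_rfl, hut, harc u hu t ht hut⟩⟩⟩

end Spacetime

theorem FlowsTo.causallyPrecedes {d : ℕ} {B : Type*} [TopologicalSpace B]
    [ChartedSpace (EuclideanSpace ℝ (Fin d)) B] [IsManifold (𝓡 d) ∞ B] {g : Spacetime d B}
    {x y : B} {t : ℝ} (h : FlowsTo g.timeField x t y) (ht : 0 < t) : g.CausallyPrecedes x y := by
  obtain ⟨a, b, γ, h0, htab, hγ, rfl, rfl⟩ := h
  exact (Spacetime.isCausalCurve_of_isMIntegralCurveOn isOpen_Ioo ordConnected_Ioo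
    hγ).causallyPrecedes h0 htab ht

namespace Spacetime

variable {d : ℕ} {B : Type*} [TopologicalSpace B] [T2Space B]
  [ChartedSpace (EuclideanSpace ℝ (Fin d)) B] [IsManifold (𝓡 d) ∞ B] {g : Spacetime d B}

/-- Without closed causal curves, the maximal integral curves of the time field are inextendible:
if such a curve had an end point `y`, then the flow for a short time `h` would fix `y`, because
`γ t` and `γ (t + h)` both converge to `y`, and the orbit of `y` would be a closed causal curve. -/
theorem exists_inextendible_flowLine (hg : ∀ p, ¬ g.CausallyPrecedes p p) (x : B) :
    ∃ (γ : ℝ → B) (s : Set ℝ), g.IsInextendibleCausalCurve γ s ∧ (0 : ℝ) ∈ s ∧ γ 0 = x ∧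
      ∀ t ∈ s, FlowsTo g.timeField x t (γ t) := by
  have : IsManifold (𝓡 d) 1 B := .of_le (n := ∞) (by norm_cast)
  have hv := g.contMDiff_one_timeField
  obtain ⟨γ, s, hso, hsc, h0, hγ0, hγ, hflow, hmax⟩ := exists_maximal_integralCurve hv x
  -- small neighbourhoods of `y` are left after a short time `h` of either sign
  have hend : ∀ y, ∃ ε > (0 : ℝ), ∀ h, |h| < ε → h ≠ 0 → ∃ V ∈ 𝓝 y, ∀ t ∈ s, γ t ∈ V →
      t + h ∈ s ∧ γ (t + h) ∉ V := by
    intro y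
    obtain ⟨U, hU, ε, hε, φ, hφc, hφ⟩ :=
      exists_local_flow hv.contMDiffAt (BoundarylessManifold.isInteriorPoint (I := 𝓡 d) (x := y))
    refine ⟨ε, hε, fun h hhε hh0 ↦ ?_⟩
    have hh : h ∈ Ioo (-ε) ε := abs_lt.1 hhε
    have hyh := hφ y (mem_of_mem_nhds hU) h hh
    have hne : y ≠ φ (y, h) := by
      intro heq
      rw [← heq] at hyh
      rcases lt_or_gt_of_ne hh0 with hlt | hgt
      · exact hg y (hyh.symm.causallyPrecedes (by linarith))
      · exact hg y (hyh.causallyPrecedes hgt)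
    obtain ⟨V₁, V₂, hV₁, hV₂, hy₁, hy₂, hdisj⟩ := t2_separation hne
    have hcont : ContinuousAt (fun x ↦ φ (x, h)) y :=
      ContinuousAt.comp (f := fun x ↦ (x, h)) (g := φ)
        (hφc.continuousAt (prod_mem_nhds hU (Ioo_mem_nhds hh.1 hh.2))) (by fun_prop)
    refine ⟨U ∩ V₁ ∩ (fun x ↦ φ (x, h)) ⁻¹' V₂, Filter.inter_mem (Filter.inter_mem hU
      (hV₁.mem_nhds hy₁)) (hcont.preimage_mem_nhds (hV₂.mem_nhds hy₂)), fun t ht htV ↦ ?_⟩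
    have hstep := (hflow t ht).trans hv (hφ (γ t) htV.1.1 h hh)
    have hts : t + h ∈ s := hmax _ _ hstep
    refine ⟨hts, fun hV ↦ hdisj.le_bot ⟨hV.1.2, ?_⟩⟩
    rw [(hflow _ hts).unique hv hstep]
    exact htV.2
  refine ⟨γ, s, ⟨isCausalCurve_of_isMIntegralCurveOn hso hsc hγ, ?_, ?_⟩, h0, hγ0, hflow⟩
  · rintro ⟨y, hy⟩
    obtain ⟨ε, hε, h⟩ := hend y
    obtain ⟨V, hV, hVs⟩ := h (ε / 2) (by rw [abs_of_pos] <;> linarith) (by linarith)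
    obtain ⟨t₀, ht₀, ht⟩ := hy V hV
    obtain ⟨h1, h2⟩ := hVs t₀ ht₀ (ht t₀ ht₀ le_rfl)
    exact h2 (ht _ h1 (by linarith))
  · rintro ⟨y, hy⟩
    obtain ⟨ε, hε, h⟩ := hend y
    obtain ⟨V, hV, hVs⟩ := h (-(ε / 2)) (by rw [abs_of_neg] <;> linarith) (by linarith)
    obtain ⟨t₀, ht₀, ht⟩ := hy V hV
    obtain ⟨h1, h2⟩ := hVs t₀ ht₀ (ht t₀ ht₀ le_rfl)
    exact h2 (ht _ h1 (by linarith))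

/-- Any causal curve from `p` to `q` extends to an inextendible one, by following the past half of
the flow line through `p` and the future half of the flow line through `q`. -/
theorem CausallyPrecedes.exists_inextendible (hg : ∀ p, ¬ g.CausallyPrecedes p p) {p q : B}
    (h : g.CausallyPrecedes p q) :
    ∃ (γ : ℝ → B) (s : Set ℝ), g.IsInextendibleCausalCurve γ s ∧ p ∈ γ '' s ∧ q ∈ γ '' s := by
  obtain ⟨γ, a, b, hab, hγ, rfl, rfl⟩ := h
  obtain ⟨α, sα, ⟨hα, -, hαp⟩, hα0, hαa, -⟩ := exists_inextendible_flowLine hg (γ a)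
  obtain ⟨β, sβ, ⟨hβ, hβf, -⟩, hβ0, hβb, -⟩ := exists_inextendible_flowLine hg (γ b)
  set α' : ℝ → B := fun t ↦ α (t + -a) with hα'
  set β' : ℝ → B := fun t ↦ β (t + -b) with hβ'
  set l : Set ℝ := (fun t ↦ t + -a) ⁻¹' sα ∩ Iic a with hl
  set r : Set ℝ := (fun t ↦ t + -b) ⁻¹' sβ ∩ Ici b with hr
  have hαl : g.IsCausalCurve α' l :=
    (hα.comp_add (-a)).mono inter_subset_left ((hα.comp_add (-a)).1.inter ordConnected_Iic)
  have hβr : g.IsCausalCurve β' r :=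
    (hβ.comp_add (-b)).mono inter_subset_left ((hβ.comp_add (-b)).1.inter ordConnected_Ici)
  have hla : IsGreatest l a := ⟨⟨by simpa using hα0, self_mem_Iic⟩, fun t ht ↦ ht.2⟩
  have hrb : IsLeast r b := ⟨⟨by simpa using hβ0, self_mem_Ici⟩, fun t ht ↦ ht.2⟩
  have h1 := hαl.piecewise hγ hla (isLeast_Icc hab.le) (by simp [hα', hαa])
  have hg2 : IsGreatest (l ∪ Icc a b) b :=
    ⟨Or.inr (right_mem_Icc.2 hab.le), by
      rintro t (ht | ht)
      · exact (hla.2 ht).trans hab.le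
      · exact ht.2⟩
  have h2 := h1.piecewise hβr hg2 hrb (by
    rw [piecewise_eq_of_notMem _ _ _ (by simpa using hab)]
    simp [hβ', hβb])
  set δ := (Iic b).piecewise ((Iic a).piecewise α' γ) β' with hδ
  have hδl : ∀ t ≤ a, δ t = α (t + -a) := fun t ht ↦ by
    rw [hδ, piecewise_eq_of_mem _ _ _ (show t ∈ Iic b from ht.trans hab.le),
      piecewise_eq_of_mem _ _ _ (show t ∈ Iic a from ht)]
  have hδr : ∀ t, b ≤ t → δ t = β (t + -b) := fun t ht ↦ by
    rcases ht.lt_or_eq with hbt | rfl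
    · rw [hδ, piecewise_eq_of_notMem _ _ _ (by simpa using hbt)]
    · rw [hδ, piecewise_eq_of_mem _ _ _ self_mem_Iic,
        piecewise_eq_of_notMem _ _ _ (by simpa using hab)]
      simp [hβb]
  refine ⟨δ, l ∪ Icc a b ∪ r, ⟨h2, ?_, ?_⟩, ⟨a, Or.inl (Or.inl hla.1), ?_⟩,
    ⟨b, Or.inr hrb.1, ?_⟩⟩
  · rintro ⟨y, hy⟩
    refine hβf ⟨y, fun U hU ↦ ?_⟩
    obtain ⟨t₀, ht₀, ht⟩ := hy U hU
    obtain ⟨t₁, ht₁, ht₀₁⟩ : ∃ t₁ ∈ r, t₀ ≤ t₁ := by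
      rcases ht₀ with ht₀ | ht₀
      · exact ⟨b, hrb.1, hg2.2 ht₀⟩
      · exact ⟨t₀, ht₀, le_rfl⟩
    refine ⟨t₁ + -b, ht₁.1, fun t hts htt ↦ ?_⟩
    have hb : b ≤ t + b := by linarith [show b ≤ t₁ from ht₁.2]
    have := ht (t + b) (Or.inr ⟨by simpa using hts, hb⟩) (by linarith)
    rw [hδr _ hb] at this
    simpa using this
  · rintro ⟨y, hy⟩
    refine hαp ⟨y, fun U hU ↦ ?_⟩
    obtain ⟨t₀, ht₀, ht⟩ := hy U hU
    obtain ⟨t₁, ht₁, ht₀₁⟩ : ∃ t₁ ∈ l, t₁ ≤ t₀ := by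
      rcases ht₀ with (ht₀ | ht₀) | ht₀
      · exact ⟨t₀, ht₀, le_rfl⟩
      · exact ⟨a, hla.1, ht₀.1⟩
      · exact ⟨a, hla.1, hab.le.trans ht₀.2⟩
    refine ⟨t₁ + -a, ht₁.1, fun t hts htt ↦ ?_⟩
    have ha : t + a ≤ a := by linarith [show t₁ ≤ a from ht₁.2]
    have := ht (t + a) (Or.inl (Or.inl ⟨by simpa using hts, ha⟩)) (by linarith)
    rw [hδl _ ha] at this
    simpa using this
  · rw [hδl a le_rfl]; simp [hαa]
  · rw [hδr b le_rfl]; simp [hβb]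

end Spacetime

/-! ### Local structure of the causal cone -/

theorem add_smul_mem_ball_of_mem_Icc {E : Type*} [NormedAddCommGroup E] [NormedSpace ℝ E]
    {z₀ z u : E} {r c t : ℝ} (hc : 0 < c) (hz : z ∈ Metric.ball z₀ r)
    (hzc : z + c • u ∈ Metric.ball z₀ r) (ht : t ∈ Icc 0 c) : z + t • u ∈ Metric.ball z₀ r := by
  have := (convex_ball z₀ r).add_smul_sub_mem hz hzc
    (t := t / c) ⟨div_nonneg ht.1 hc.le, div_le_one_of_le₀ ht.2 hc.le⟩
  rwa [add_sub_cancel_left, smul_smul, div_mul_cancel₀ _ hc.ne'] at this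

namespace Spacetime

variable {d : ℕ} {B : Type*} [TopologicalSpace B]
  [ChartedSpace (EuclideanSpace ℝ (Fin d)) B] [IsManifold (𝓡 d) ∞ B] {g : Spacetime d B}

theorem IsCausalArc.causallyPrecedes {γ : ℝ → B} {a b : ℝ} (h : g.IsCausalArc γ a b) :
    g.CausallyPrecedes (γ a) (γ b) := by
  refine ⟨γ, a, b, h.1, ⟨ordConnected_Icc, fun t ht ↦ ⟨fun u hu htu ↦ ?_, fun u hu hut ↦ ?_⟩⟩,
    rfl, rfl⟩
  · exact ⟨u, htu, le_rfl, h.mono ht.1 htu hu.2⟩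
  · exact ⟨u, le_rfl, hut, h.mono hu.1 hut ht.2⟩

variable (g) in
/-- Timelike vectors in the future cone form an open subset of the tangent bundle. -/
theorem isOpen_timelikeFuture : IsOpen {v : TangentBundle (𝓡 d) B |
    g.metric.inner v.1 v.2 v.2 < 0 ∧ g.metric.inner v.1 v.2 (g.timeField v.1) < 0} := by
  have hmet : Continuous fun b : B ↦ Bundle.TotalSpace.mk'
      (EuclideanSpace ℝ (Fin d) →L[ℝ] EuclideanSpace ℝ (Fin d) →L[ℝ] ℝ)
      (E := fun b ↦ TangentSpace (𝓡 d) b →L[ℝ] TangentSpace (𝓡 d) b →L[ℝ] ℝ)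
      b (g.metric.inner b) := g.metric.contMDiff.continuous
  have hproj : Continuous fun v : TangentBundle (𝓡 d) B ↦ v.1 :=
    FiberBundle.continuous_proj _ _
  have key : ∀ w : (v : TangentBundle (𝓡 d) B) → TangentSpace (𝓡 d) v.1,
      Continuous (fun v ↦ (⟨v.1, w v⟩ : TangentBundle (𝓡 d) B)) →
      Continuous fun v : TangentBundle (𝓡 d) B ↦ g.metric.inner v.1 v.2 (w v) := by
    intro w hw
    have : Continuous (fun v : TangentBundle (𝓡 d) B ↦ Bundle.TotalSpace.mk' ℝ
        (E := Bundle.Trivial B ℝ) v.1 (g.metric.inner v.1 v.2 (w v))) :=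
      Continuous.clm_bundle_apply₂ (F₁ := EuclideanSpace ℝ (Fin d))
        (F₂ := EuclideanSpace ℝ (Fin d)) (hmet.comp hproj) continuous_id hw
    rw [continuous_iff_continuousAt] at this ⊢
    intro v
    have h := this v
    simp only [FiberBundle.continuousAt_totalSpace] at h
    exact h.2
  have h1 := key (fun v ↦ v.2) continuous_id
  have h2 := key (fun v ↦ g.timeField v.1) (g.contMDiff_timeField.continuous.comp hproj)
  exact (isOpen_lt h1 continuous_const).inter (isOpen_lt h2 continuous_const)

variable (g) in
/-- Let `w` be the time field at `x` read in the chart at `x`. In this chart, segments near `x` which point approximately in the direction of the time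
field are causal. -/
theorem exists_chart_cone (x : B) {w : EuclideanSpace ℝ (Fin d)}
    (hw : mfderiv (𝓡 d) 𝓘(ℝ, EuclideanSpace ℝ (Fin d)) (extChartAt (𝓡 d) x) x (g.timeField x) =
      w) :
    ∃ r > (0 : ℝ), ∀ z ∈ Metric.ball (extChartAt (𝓡 d) x x) r, ∀ u ∈ Metric.ball w r, ∀ c > (0 : ℝ),
      z + c • u ∈ Metric.ball (extChartAt (𝓡 d) x x) r →
      g.CausallyPrecedes ((extChartAt (𝓡 d) x).symm z)
        ((extChartAt (𝓡 d) x).symm (z + c • u)) := by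
  set z₀ : EuclideanSpace ℝ (Fin d) := extChartAt (𝓡 d) x x with hz₀
  set ψ : EuclideanSpace ℝ (Fin d) → B := ⇑(extChartAt (𝓡 d) x).symm with hψ
  set Z : Set (EuclideanSpace ℝ (Fin d)) := (extChartAt (𝓡 d) x).target with hZ
  have hZo : IsOpen Z := isOpen_extChartAt_target x
  have hz₀Z : z₀ ∈ Z := mem_extChartAt_target x
  have hsmooth : ContMDiffOn 𝓘(ℝ, EuclideanSpace ℝ (Fin d)) (𝓡 d) ∞ ψ Z :=
    contMDiffOn_extChartAt_symm x
  have hZu : UniqueMDiffOn 𝓘(ℝ, EuclideanSpace ℝ (Fin d)) Z := hZo.uniqueMDiffOn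
  let F : EuclideanSpace ℝ (Fin d) × EuclideanSpace ℝ (Fin d) → TangentBundle (𝓡 d) B :=
    fun p ↦ ⟨ψ p.1, mfderivWithin 𝓘(ℝ, EuclideanSpace ℝ (Fin d)) (𝓡 d) ψ Z p.1 p.2⟩
  have hFc : ContinuousOn F (Z ×ˢ univ) := by
    refine (hsmooth.continuousOn_tangentMapWithin (by norm_cast) hZu).comp
      (f := fun p : EuclideanSpace ℝ (Fin d) × EuclideanSpace ℝ (Fin d) ↦
        (⟨p.1, p.2⟩ : TangentBundle 𝓘(ℝ, EuclideanSpace ℝ (Fin d)) _)) ?_ ?_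
    · exact (tangentBundleModelSpaceHomeomorph
        𝓘(ℝ, EuclideanSpace ℝ (Fin d))).symm.continuous.continuousOn
    · exact fun p hp ↦ hp.1
  set O := {v : TangentBundle (𝓡 d) B |
    g.metric.inner v.1 v.2 v.2 < 0 ∧ g.metric.inner v.1 v.2 (g.timeField v.1) < 0} with hO
  -- `ψ z₀ = x` only propositionally, so the base point is generalized before comparing vectors
  have hOx : ∀ b : B, b = x → ∀ u : EuclideanSpace ℝ (Fin d), u = g.timeField x →
      (⟨b, u⟩ : TangentBundle (𝓡 d) B) ∈ O := by
    rintro b rfl u rfl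
    exact ⟨g.timelike b, g.timelike b⟩
  have hO0 : F (z₀, w) ∈ O := by
    refine hOx _ (extChartAt_to_inv x) _ ?_
    have h := mfderivWithin_extChartAt_symm_comp_mfderiv_extChartAt' (I := 𝓡 d)
      (mem_extChartAt_source x)
    rw [ModelWithCorners.range_eq_univ, mfderivWithin_univ] at h
    have h' := congrArg (fun L ↦ L (g.timeField x)) h
    change mfderivWithin 𝓘(ℝ, EuclideanSpace ℝ (Fin d)) (𝓡 d) ψ Z z₀ w = _
    rw [mfderivWithin_of_mem_nhds (hZo.mem_nhds hz₀Z), ← hw]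
    exact h'
  have hnhds : F ⁻¹' O ∩ Z ×ˢ univ ∈ 𝓝 (z₀, w) := by
    have hmem : Z ×ˢ univ ∈ 𝓝 (z₀, w) := prod_mem_nhds (hZo.mem_nhds hz₀Z) Filter.univ_mem
    refine Filter.inter_mem ((hFc.continuousAt hmem).preimage_mem_nhds
      (g.isOpen_timelikeFuture.mem_nhds hO0)) hmem
  -- in the sup metric of the product, one radius serves for both the points and the directions
  obtain ⟨r, hr, hsub⟩ := Metric.mem_nhds_iff.1 hnhds
  rw [← ball_prod_same] at hsub
  have hcone : ∀ z ∈ Metric.ball z₀ r, ∀ u ∈ Metric.ball w r, z ∈ Z ∧ F (z, u) ∈ O := by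
    intro z hz u hu
    have h := hsub (mk_mem_prod hz hu)
    exact ⟨(mem_prod.1 (mem_of_mem_inter_right h)).1, mem_preimage.1 (mem_of_mem_inter_left h)⟩
  refine ⟨r, hr, fun z hz u hu c hc hzc ↦ ?_⟩
  have hseg : ∀ t ∈ Icc 0 c, z + t • u ∈ Metric.ball z₀ r := by
    intro t ht
    exact add_smul_mem_ball_of_mem_Icc hc hz hzc ht
  have hmaps : MapsTo (fun t : ℝ ↦ z + t • u) (Icc 0 c) Z := fun t ht ↦
    (hcone _ (hseg t ht) u hu).1
  have hline : ContMDiff 𝓘(ℝ, ℝ) 𝓘(ℝ, EuclideanSpace ℝ (Fin d)) 1 (fun t : ℝ ↦ z + t • u) :=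
    ContDiff.contMDiff (by fun_prop)
  have harc : g.IsCausalArc (fun t ↦ ψ (z + t • u)) 0 c := by
    refine isCausalArc_of_hasMFDerivWithinAt hc
      ((hsmooth.of_le (by norm_cast)).comp hline.contMDiffOn hmaps) fun t ht ↦ ?_
    refine ⟨(F (z + t • u, u)).2, ?_, ?_⟩
    · obtain ⟨h1, h2⟩ := (hcone _ (hseg t ht) u hu).2
      refine ⟨fun h0 ↦ ?_, h1.le, h2⟩
      rw [h0] at h1
      simp at h1
    · have hd1 : HasMFDerivWithinAt 𝓘(ℝ, ℝ) 𝓘(ℝ, EuclideanSpace ℝ (Fin d))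
          (fun t : ℝ ↦ z + t • u) (Icc 0 c) t ((1 : ℝ →L[ℝ] ℝ).smulRight u) := by
        have := ((hasDerivAt_id t).smul_const u).const_add z
        rw [one_smul] at this
        exact this.hasFDerivAt.hasFDerivWithinAt.hasMFDerivWithinAt
      have hd2 := ((hsmooth (z + t • u) (hmaps ht)).mdifferentiableWithinAt
        (by norm_cast)).hasMFDerivWithinAt
      have hd := HasMFDerivWithinAt.comp t hd2 hd1 hmaps
      refine hd.congr_mfderiv ?_
      refine ContinuousLinearMap.ext_ring ?_
      exact (mfderivWithin 𝓘(ℝ, EuclideanSpace ℝ (Fin d)) (𝓡 d) ψ Z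
        (z + t • u)).map_smul (1 : ℝ) u
  have := harc.causallyPrecedes
  simp only [zero_smul, add_zero] at this
  exact this

/-- Points of an integral curve of the time field through `x` lying slightly in the past (future) of
`x` causally precede (succeed) all points of some neighbourhood of `x`. -/
theorem eventually_causallyPrecedes_nhds {γ : ℝ → B} {x : B} (h0 : γ 0 = x)
    (h : IsMIntegralCurveAt γ g.timeField 0) :
    ∀ᶠ t in 𝓝[≠] (0 : ℝ), ∀ᶠ y in 𝓝 x,
      (t < 0 → g.CausallyPrecedes (γ t) y) ∧ (0 < t → g.CausallyPrecedes y (γ t)) := by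
  subst h0
  obtain ⟨w, hw⟩ : ∃ w : EuclideanSpace ℝ (Fin d), mfderiv (𝓡 d) 𝓘(ℝ, EuclideanSpace ℝ (Fin d))
    (extChartAt (𝓡 d) (γ 0)) (γ 0) (g.timeField (γ 0)) = w := ⟨_, rfl⟩
  obtain ⟨r, hr, hcone⟩ := g.exists_chart_cone (γ 0) hw
  set φ : B → EuclideanSpace ℝ (Fin d) := ⇑(extChartAt (𝓡 d) (γ 0)) with hφ
  have hφc : ContinuousAt φ (γ 0) := continuousAt_extChartAt (γ 0)
  have hderiv : HasDerivAt (φ ∘ γ) w 0 := by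
    have h1 : HasMFDerivAt (𝓡 d) 𝓘(ℝ, EuclideanSpace ℝ (Fin d)) φ (γ 0)
        (mfderiv (𝓡 d) 𝓘(ℝ, EuclideanSpace ℝ (Fin d)) φ (γ 0)) :=
      (mdifferentiableAt_extChartAt (mem_chart_source _ _)).hasMFDerivAt
    have h2 : HasMFDerivAt 𝓘(ℝ, ℝ) 𝓘(ℝ, EuclideanSpace ℝ (Fin d)) (φ ∘ γ) 0
        ((1 : ℝ →L[ℝ] ℝ).smulRight w) := by
      refine (HasMFDerivAt.comp (0 : ℝ) h1 h.hasMFDerivAt).congr_mfderiv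
        (ContinuousLinearMap.ext_ring ?_)
      rw [← hw]
      exact (mfderiv (𝓡 d) 𝓘(ℝ, EuclideanSpace ℝ (Fin d)) φ (γ 0)).map_smul (1 : ℝ)
        (g.timeField (γ 0))
    have h3 : HasFDerivAt (φ ∘ γ) ((1 : ℝ →L[ℝ] ℝ).smulRight w) 0 := h2.hasFDerivAt
    have h4 := h3.hasDerivAt
    rwa [ContinuousLinearMap.smulRight_apply, one_apply_eq_self, one_smul] at h4
  have hγ : ContinuousAt γ 0 := h.continuousAt
  have hslope := (hasDerivAt_iff_tendsto_slope.1 hderiv).eventually (Metric.ball_mem_nhds w hr)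
  have hsrc : ∀ᶠ y in 𝓝 (γ 0), φ y ∈ Metric.ball (φ (γ 0)) r ∧
      (extChartAt (𝓡 d) (γ 0)).symm (φ y) = y := by
    filter_upwards [hφc.preimage_mem_nhds (Metric.ball_mem_nhds _ hr),
      extChartAt_source_mem_nhds (I := 𝓡 d) (γ 0)] with y hy hys
    exact ⟨hy, (extChartAt (𝓡 d) (γ 0)).left_inv hys⟩
  filter_upwards [hslope, nhdsWithin_le_nhds (hγ.eventually hsrc), self_mem_nhdsWithin]
    with t hts htb ht0
  -- the slope of the segment from `y` to `γ t` depends continuously on `y`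
  have hcont : ContinuousAt (fun y ↦ t⁻¹ • (φ (γ t) - φ y)) (γ 0) := by fun_prop
  have hball : ∀ᶠ y in 𝓝 (γ 0), t⁻¹ • (φ (γ t) - φ y) ∈ Metric.ball w r := by
    refine hcont.preimage_mem_nhds (Metric.isOpen_ball.mem_nhds ?_)
    simpa [slope_def_module] using hts
  have ht0' : t ≠ 0 := ht0
  filter_upwards [hball, hsrc] with y hy hys
  refine ⟨fun ht ↦ ?_, fun ht ↦ ?_⟩
  · have heq : φ (γ t) + (-t) • (t⁻¹ • (φ (γ t) - φ y)) = φ y := by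
      rw [smul_smul, neg_mul, mul_inv_cancel₀ ht0', neg_one_smul]
      abel
    have := hcone _ htb.1 _ hy (-t) (by linarith) (by rw [heq]; exact hys.1)
    rwa [heq, htb.2, hys.2] at this
  · have heq : φ y + t • (t⁻¹ • (φ (γ t) - φ y)) = φ (γ t) := by
      rw [smul_smul, mul_inv_cancel₀ ht0', one_smul]
      abel
    have := hcone _ hys.1 _ hy t ht (by rw [heq]; exact htb.1)
    rwa [heq, htb.2, hys.2] at this

end Spacetime

/-! ### Cauchy slices -/

namespace Spacetime

variable {d : ℕ} {B : Type*} [TopologicalSpace B]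
  [ChartedSpace (EuclideanSpace ℝ (Fin d)) B] [IsManifold (𝓡 d) ∞ B] {g : Spacetime d B}

theorem IsCausalCurve.eq_or_causallyPrecedes {γ : ℝ → B} {s : Set ℝ} (h : g.IsCausalCurve γ s)
    {p q : B} (hp : p ∈ γ '' s) (hq : q ∈ γ '' s) :
    p = q ∨ g.CausallyPrecedes q p ∨ g.CausallyPrecedes p q := by
  obtain ⟨t, ht, rfl⟩ := hp
  obtain ⟨u, hu, rfl⟩ := hq
  rcases lt_trichotomy t u with htu | rfl | htu
  · exact Or.inr (Or.inr (h.causallyPrecedes ht hu htu))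
  · exact Or.inl rfl
  · exact Or.inr (Or.inl (h.causallyPrecedes hu ht htu))

theorem IsAcausal.not_causallyPrecedes (hg : ∀ p, ¬ g.CausallyPrecedes p p) {S : Set B}
    (hS : g.IsAcausal S) {p q : B} (hp : p ∈ S) (hq : q ∈ S) : ¬ g.CausallyPrecedes p q := by
  rcases eq_or_ne p q with rfl | hpq
  · exact hg p
  · exact hS p hp q hq hpq

/-- A point outside `D[X]` is causally related to a point of the Cauchy slice outside `X`. -/
theorem exists_of_notMem_domainOfDependence {S X : Set B} (hS : g.domainOfDependence S = univ)
    {p : B} (hp : p ∉ g.domainOfDependence X) :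
    ∃ q ∈ S \ X, p = q ∨ g.CausallyPrecedes q p ∨ g.CausallyPrecedes p q := by
  simp only [domainOfDependence, mem_ofPred_eq, not_forall] at hp
  obtain ⟨γ, s, hγ, hps, hX⟩ := hp
  have hpS : p ∈ g.domainOfDependence S := hS ▸ mem_univ p
  obtain ⟨q, hqs, hqS⟩ := hpS γ s hγ hps
  exact ⟨q, ⟨hqS, fun hqX ↦ hX ⟨q, hqs, hqX⟩⟩, hγ.1.eq_or_causallyPrecedes hps hqs⟩

variable [T2Space B]

theorem exists_of_mem_domainOfDependence (hg : ∀ p, ¬ g.CausallyPrecedes p p) {X : Set B} {p : B}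
    (hp : p ∈ g.domainOfDependence X) : ∃ t, ∃ q ∈ X, FlowsTo g.timeField p t q := by
  obtain ⟨γ, s, hγ, h0, hγ0, hflow⟩ := exists_inextendible_flowLine hg p
  obtain ⟨q, ⟨t, ht, rfl⟩, hqX⟩ := hp γ s hγ ⟨0, h0, hγ0⟩
  exact ⟨t, _, hqX, hflow t ht⟩

/-- An inextendible causal curve through a point of `D[X]` and a point of `Y` would meet the acausal
set `S` twice if `X` and `Y` are disjoint parts of it. -/
theorem not_related_of_mem_domainOfDependence (hg : ∀ p, ¬ g.CausallyPrecedes p p) {S X Y : Set B}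
    (hS : g.IsAcausal S) (hX : X ⊆ S) (hY : Y ⊆ S) (hXY : Disjoint X Y) {p y : B}
    (hp : p ∈ g.domainOfDependence X) (hy : y ∈ Y) :
    ¬ (p = y ∨ g.CausallyPrecedes y p ∨ g.CausallyPrecedes p y) := by
  intro h
  obtain ⟨γ, s, hγ, hps, hys⟩ : ∃ (γ : ℝ → B) (s : Set ℝ), g.IsInextendibleCausalCurve γ s ∧
      p ∈ γ '' s ∧ y ∈ γ '' s := by
    rcases h with rfl | h | h
    · obtain ⟨γ, s, hγ, h0, hγ0, -⟩ := exists_inextendible_flowLine hg p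
      exact ⟨γ, s, hγ, ⟨0, h0, hγ0⟩, ⟨0, h0, hγ0⟩⟩
    · obtain ⟨γ, s, hγ, h1, h2⟩ := h.exists_inextendible hg
      exact ⟨γ, s, hγ, h2, h1⟩
    · exact h.exists_inextendible hg
  obtain ⟨x, hxs, hxX⟩ := hp γ s hγ hps
  rcases hγ.1.eq_or_causallyPrecedes hxs hys with rfl | h | h
  · exact disjoint_left.1 hXY hxX hy
  · exact hS.not_causallyPrecedes hg (hY hy) (hX hxX) h
  · exact hS.not_causallyPrecedes hg (hX hxX) (hY hy) h

/-- The flow lines of the time field meet an acausal set at most once. -/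
theorem IsAcausal.eq_of_flowsTo (hg : ∀ p, ¬ g.CausallyPrecedes p p) {S : Set B}
    (hS : g.IsAcausal S) {x y y' : B} {t t' : ℝ} (hy : y ∈ S) (hy' : y' ∈ S)
    (h : FlowsTo g.timeField x t y) (h' : FlowsTo g.timeField x t' y') : y = y' := by
  have : IsManifold (𝓡 d) 1 B := .of_le (n := ∞) (by norm_cast)
  have hyy := h.symm.trans g.contMDiff_one_timeField h'
  rcases lt_trichotomy (-t + t') 0 with hlt | heq | hgt
  · exact absurd (hyy.symm.causallyPrecedes (by linarith)) (hS.not_causallyPrecedes hg hy' hy)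
  · rw [heq] at hyy
    exact hyy.eq_of_time_zero
  · exact absurd (hyy.causallyPrecedes hgt) (hS.not_causallyPrecedes hg hy hy')

/-- The strict causal future of a Cauchy slice is open: it is filled by the flow lines of the time
field starting on the slice, and these can be tilted slightly near their end points. -/
theorem IsCauchySlice.isOpen_strictFuture (hg : ∀ p, ¬ g.CausallyPrecedes p p) {S : Set B}
    (hS : g.IsCauchySlice S) : IsOpen {x | ∃ y ∈ S, g.CausallyPrecedes y x} := by
  rw [isOpen_iff_mem_nhds]
  rintro x ⟨z, hz, hzx⟩
  obtain ⟨t, y, hy, hxy⟩ := exists_of_mem_domainOfDependence hg (hS.2.2 ▸ mem_univ x)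
  have ht : t < 0 := by
    by_contra! ht
    refine hS.2.1.not_causallyPrecedes hg hz hy ?_
    rcases ht.lt_or_eq with ht | rfl
    · exact hzx.trans (hxy.causallyPrecedes ht)
    · exact hxy.eq_of_time_zero ▸ hzx
  obtain ⟨a, b, γ, h0, htab, hγ, hγ0, rfl⟩ := hxy
  have hev := eventually_causallyPrecedes_nhds hγ0 (hγ.isMIntegralCurveAt (Ioo_mem_nhds h0.1 h0.2))
  obtain ⟨τ, hτ, hτt⟩ := ((hev.filter_mono (nhdsWithin_mono (0 : ℝ) (fun τ (hτ : τ ∈ Iio 0) ↦ ne_of_lt hτ))).and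
    (Ioo_mem_nhdsLT ht)).exists
  filter_upwards [hτ] with x' hx'
  have hγτ := (hγ.flowsTo htab ⟨htab.1.trans hτt.1, hτt.2.trans h0.2⟩).causallyPrecedes
    (sub_pos.2 hτt.1)
  exact ⟨_, hy, hγτ.trans (hx'.1 hτt.2)⟩

theorem IsCauchySlice.isOpen_strictPast (hg : ∀ p, ¬ g.CausallyPrecedes p p) {S : Set B}
    (hS : g.IsCauchySlice S) : IsOpen {x | ∃ y ∈ S, g.CausallyPrecedes x y} := by
  rw [isOpen_iff_mem_nhds]
  rintro x ⟨z, hz, hzx⟩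
  obtain ⟨t, y, hy, hxy⟩ := exists_of_mem_domainOfDependence hg (hS.2.2 ▸ mem_univ x)
  have ht : 0 < t := by
    by_contra! ht
    refine hS.2.1.not_causallyPrecedes hg hy hz ?_
    rcases ht.lt_or_eq with ht | rfl
    · exact (hxy.symm.causallyPrecedes (neg_pos.2 ht)).trans hzx
    · exact hxy.eq_of_time_zero ▸ hzx
  obtain ⟨a, b, γ, h0, htab, hγ, hγ0, rfl⟩ := hxy
  have hev := eventually_causallyPrecedes_nhds hγ0 (hγ.isMIntegralCurveAt (Ioo_mem_nhds h0.1 h0.2))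
  obtain ⟨τ, hτ, hτt⟩ := ((hev.filter_mono (nhdsWithin_mono (0 : ℝ) (fun τ (hτ : τ ∈ Ioi 0) ↦ ne_of_gt hτ))).and
    (Ioo_mem_nhdsGT ht)).exists
  filter_upwards [hτ] with x' hx'
  have hγτ := (hγ.flowsTo ⟨h0.1.trans hτt.1, hτt.2.trans htab.2⟩ htab).causallyPrecedes
    (sub_pos.2 hτt.2)
  exact ⟨_, hy, (hx'.2 hτt.1).trans hγτ⟩

/-- The flow lines which meet a relatively open part of a Cauchy slice fill an open set. Near the
slice this is the intermediate value theorem: a flow line close to one which crosses the slice runs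
from the strict past to the strict future of the slice, and these two open sets are disjoint. -/
theorem IsCauchySlice.isOpen_flow_saturation (hg : ∀ p, ¬ g.CausallyPrecedes p p) {S V : Set B}
    (hS : g.IsCauchySlice S) (hV : IsOpen V) :
    IsOpen {x | ∃ t, ∃ y ∈ S ∩ V, FlowsTo g.timeField x t y} := by
  have : IsManifold (𝓡 d) 1 B := .of_le (n := ∞) (by norm_cast)
  have hv := g.contMDiff_one_timeField
  refine _root_.isOpen_flow_saturation hv ?_
  rintro y ⟨hyS, hyV⟩
  obtain ⟨U, hU, ε, hε, φ, hφc, hφ⟩ :=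
    exists_local_flow hv.contMDiffAt (BoundarylessManifold.isInteriorPoint (I := 𝓡 d) (x := y))
  have hyU := mem_of_mem_nhds hU
  have hφ0 : φ (y, 0) = y := ((hφ y hyU 0 ⟨by linarith, hε⟩).unique hv (FlowsTo.refl hv y))
  have hcont : ∀ t ∈ Ioo (-ε) ε, ContinuousAt φ (y, t) := fun t ht ↦
    hφc.continuousAt (prod_mem_nhds hU (Ioo_mem_nhds ht.1 ht.2))
  have hnhds : φ ⁻¹' V ∈ 𝓝 (y, (0 : ℝ)) :=
    (hcont 0 ⟨by linarith, hε⟩).preimage_mem_nhds (hV.mem_nhds (by rwa [hφ0]))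
  obtain ⟨U', hU', T, hT, hUT⟩ := mem_nhds_prod_iff.1 hnhds
  obtain ⟨η, hη, hηT⟩ := Metric.mem_nhds_iff.1 hT
  set δ := min ε η / 2 with hδ
  have hmin : 0 < min ε η := lt_min hε hη
  have hδ0 : 0 < δ := by positivity
  have hδε : δ < ε := by linarith [min_le_left ε η]
  have hδη : δ < η := by linarith [min_le_right ε η]
  have hIcc : Icc (-δ) δ ⊆ Ioo (-ε) ε := fun t ht ↦ ⟨by linarith [ht.1], by linarith [ht.2]⟩
  have hδmem : δ ∈ Icc (-δ) δ := ⟨by linarith, le_rfl⟩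
  have hδmem' : -δ ∈ Icc (-δ) δ := ⟨le_rfl, by linarith⟩
  have hat : ∀ t ∈ Ioo (-ε) ε, ContinuousAt (fun x ↦ φ (x, t)) y := fun t ht ↦
    ContinuousAt.comp (f := fun x ↦ (x, t)) (g := φ) (hcont t ht) (by fun_prop)
  have hfut := (hat δ (hIcc hδmem)).preimage_mem_nhds ((hS.isOpen_strictFuture hg).mem_nhds
    ⟨y, hyS, (hφ y hyU δ (hIcc hδmem)).causallyPrecedes hδ0⟩)
  have hpast := (hat (-δ) (hIcc hδmem')).preimage_mem_nhds ((hS.isOpen_strictPast hg).mem_nhds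
    ⟨y, hyS, (hφ y hyU (-δ) (hIcc hδmem')).symm.causallyPrecedes (by linarith)⟩)
  filter_upwards [hU, hU', hfut, hpast] with x hxU hxU' hxf hxp
  have hpre : IsPreconnected ((fun t ↦ φ (x, t)) '' Icc (-δ) δ) := by
    refine isPreconnected_Icc.image _ (hφc.comp (by fun_prop) fun t ht ↦ ⟨hxU, hIcc ht⟩)
  -- if the flow line through `x` missed the slice, it would be covered by two disjoint open sets
  obtain ⟨t, ht, htS⟩ : ∃ t ∈ Icc (-δ) δ, φ (x, t) ∈ S := by
    by_contra! hno
    obtain ⟨z, -, ⟨y₁, hy₁, h₁⟩, ⟨y₂, hy₂, h₂⟩⟩ := hpre _ _ (hS.isOpen_strictFuture hg)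
      (hS.isOpen_strictPast hg) (by
        rintro _ ⟨t, ht, rfl⟩
        obtain ⟨u, z, hz, hzu⟩ :=
          exists_of_mem_domainOfDependence hg (hS.2.2 ▸ mem_univ (φ (x, t)))
        rcases lt_trichotomy u 0 with hu | rfl | hu
        · exact Or.inl ⟨z, hz, hzu.symm.causallyPrecedes (by linarith)⟩
        · exact absurd (hzu.eq_of_time_zero ▸ hz) (hno t ht)
        · exact Or.inr ⟨z, hz, hzu.causallyPrecedes hu⟩)
      ⟨_, ⟨δ, hδmem, rfl⟩, hxf⟩ ⟨_, ⟨-δ, hδmem', rfl⟩, hxp⟩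
    exact hS.2.1.not_causallyPrecedes hg hy₁ hy₂ (h₁.trans h₂)
  refine ⟨t, φ (x, t), ⟨htS, hUT ⟨hxU', hηT ?_⟩⟩, hφ x hxU t (hIcc ht)⟩
  rw [Real.ball_eq_Ioo]
  exact ⟨by linarith [ht.1], by linarith [ht.2]⟩

/-- If `p` is causally related to a point of a relatively open part `S ∩ V` of the slice, but to no
point of `S` outside the disjoint parts `S ∩ V` and `S ∩ V'`, then the flow line through `p` crosses
the slice in `S ∩ V`: following the causal curve to `p`, the crossing point cannot jump to
`S ∩ V'`. -/
theorem IsCauchySlice.exists_flowsTo_of_related (hg : ∀ p, ¬ g.CausallyPrecedes p p)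
    {S V V' : Set B} (hS : g.IsCauchySlice S) (hV : IsOpen V) (hV' : IsOpen V')
    (hdisj : Disjoint (S ∩ V) (S ∩ V')) {p q : B} (hq : q ∈ S ∩ V)
    (hpq : p = q ∨ g.CausallyPrecedes q p ∨ g.CausallyPrecedes p q)
    (hp : ∀ y ∈ S, y ∉ V → y ∉ V' → ¬ g.CausallyPrecedes y p ∧ ¬ g.CausallyPrecedes p y) :
    ∃ t, ∃ y ∈ S ∩ V, FlowsTo g.timeField p t y := by
  have : IsManifold (𝓡 d) 1 B := .of_le (n := ∞) (by norm_cast)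
  have hqW : ∃ t, ∃ y ∈ S ∩ V, FlowsTo g.timeField q t y :=
    ⟨0, q, hq, FlowsTo.refl g.contMDiff_one_timeField q⟩
  have hWdisj : Disjoint {x | ∃ t, ∃ y ∈ S ∩ V, FlowsTo g.timeField x t y}
      {x | ∃ t, ∃ y ∈ S ∩ V', FlowsTo g.timeField x t y} := by
    rw [disjoint_left]
    rintro x ⟨t, y, hy, h⟩ ⟨t', y', hy', h'⟩
    have heq := hS.2.1.eq_of_flowsTo hg hy.1 hy'.1 h h'
    exact disjoint_left.1 hdisj hy (heq ▸ hy')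
  -- on `K` the flow lines cross the slice in `S ∩ V` or in `S ∩ V'`, and connectedness decides
  have key : ∀ K : Set B, IsPreconnected K → q ∈ K → p ∈ K →
      (∀ x ∈ K, ∀ y ∈ S, y ∉ V → y ∉ V' → ∀ t, ¬ FlowsTo g.timeField x t y) →
      ∃ t, ∃ y ∈ S ∩ V, FlowsTo g.timeField p t y := by
    intro K hK hqK hpK hKS
    refine hK.subset_left_of_subset_union (hS.isOpen_flow_saturation hg hV)
      (hS.isOpen_flow_saturation hg hV') hWdisj (fun x hx ↦ ?_) ⟨q, hqK, hqW⟩ hpK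
    obtain ⟨t, y, hy, hxy⟩ := exists_of_mem_domainOfDependence hg (hS.2.2 ▸ mem_univ x)
    by_cases hyV : y ∈ V
    · exact Or.inl ⟨t, y, ⟨hy, hyV⟩, hxy⟩
    · by_cases hyV' : y ∈ V'
      · exact Or.inr ⟨t, y, ⟨hy, hyV'⟩, hxy⟩
      · exact absurd hxy (hKS x hx y hy hyV hyV' t)
  have hne : ∀ y, y ∉ V → q ≠ y := fun y hy h ↦ hy (h ▸ hq.2)
  rcases hpq with rfl | h | h
  · exact hqW
  · obtain ⟨γ, a, b, hab, hγ, rfl, rfl⟩ := h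
    refine key (γ '' Icc a b) (isPreconnected_Icc.image _ hγ.continuousOn)
      ⟨a, left_mem_Icc.2 hab.le, rfl⟩ ⟨b, right_mem_Icc.2 hab.le, rfl⟩ ?_
    rintro _ ⟨u, hu, rfl⟩ y hy hyV hyV' t hflow
    -- `y` lies after the point `γ u`, hence after `q`, or before it, hence before `p`
    have hqy := hS.2.1.not_causallyPrecedes hg hq.1 hy
    have hyp := (hp y hy hyV hyV').1
    rcases lt_trichotomy t 0 with ht | rfl | ht
    · have h1 := hflow.symm.causallyPrecedes (neg_pos.2 ht)
      rcases hu.2.lt_or_eq with hub | rfl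
      · exact hyp (h1.trans (hγ.causallyPrecedes hu (right_mem_Icc.2 hab.le) hub))
      · exact hyp h1
    · have heq := hflow.eq_of_time_zero
      rcases hu.1.lt_or_eq with hau | rfl
      · exact hqy (heq ▸ hγ.causallyPrecedes (left_mem_Icc.2 hab.le) hu hau)
      · exact hne y hyV heq
    · have h1 := hflow.causallyPrecedes ht
      rcases hu.1.lt_or_eq with hau | rfl
      · exact hqy ((hγ.causallyPrecedes (left_mem_Icc.2 hab.le) hu hau).trans h1)
      · exact hqy h1
  · obtain ⟨γ, a, b, hab, hγ, rfl, rfl⟩ := h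
    refine key (γ '' Icc a b) (isPreconnected_Icc.image _ hγ.continuousOn)
      ⟨b, right_mem_Icc.2 hab.le, rfl⟩ ⟨a, left_mem_Icc.2 hab.le, rfl⟩ ?_
    rintro _ ⟨u, hu, rfl⟩ y hy hyV hyV' t hflow
    -- `y` lies before the point `γ u`, hence before `q`, or after it, hence after `p`
    have hyq := hS.2.1.not_causallyPrecedes hg hy hq.1
    have hpy := (hp y hy hyV hyV').2
    rcases lt_trichotomy t 0 with ht | rfl | ht
    · have h1 := hflow.symm.causallyPrecedes (neg_pos.2 ht)
      rcases hu.2.lt_or_eq with hub | rfl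
      · exact hyq (h1.trans (hγ.causallyPrecedes hu (right_mem_Icc.2 hab.le) hub))
      · exact hyq h1
    · have heq := hflow.eq_of_time_zero
      rcases hu.2.lt_or_eq with hub | rfl
      · exact hyq (heq ▸ hγ.causallyPrecedes hu (right_mem_Icc.2 hab.le) hub)
      · exact hne y hyV heq
    · have h1 := hflow.causallyPrecedes ht
      rcases hu.1.lt_or_eq with hau | rfl
      · exact hpy ((hγ.causallyPrecedes (left_mem_Icc.2 hab.le) hu hau).trans h1)
      · exact hpy h1

end Spacetime

/-! ### The decomposition of the spacetime -/

theorem exists_isOpen_image_val_eq_inter {B : Type*} [TopologicalSpace B] {S : Set B} {U : Set S}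
    (hU : IsOpen U) : ∃ V : Set B, IsOpen V ∧ Subtype.val '' U = S ∩ V := by
  obtain ⟨V, hV, rfl⟩ := isOpen_induced_iff.1 hU
  exact ⟨V, hV, Subtype.image_preimage_coe S V⟩

/-- `N` is the closed region of the Cauchy slice `S` (such as a closed codimension-zero submanifold
with boundary), `A` its interior in `S`, `bA` its boundary in `S`, and `Ac` the complement. -/
theorem mainTheorem6 {d : ℕ} {B : Type*} [TopologicalSpace B] [T2Space B]
    [SecondCountableTopology B] [ChartedSpace (EuclideanSpace ℝ (Fin d)) B]
    [IsManifold (𝓡 d) ∞ B] (g : Spacetime d B) (hg : g.IsGloballyHyperbolic)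
    (S : Set B) (hS : g.IsCauchySlice S) (N : Set B) (hNS : N ⊆ S) (hN : IsClosed N)
    (A bA Ac : Set B) (hA : A = relInterior S N) (hbA : bA = relBoundary S N)
    (hAc : Ac = S \ (A ∪ bA)) :
    g.domainOfDependence A ∪ g.domainOfDependence Ac ∪ g.causalFuture bA ∪ g.causalPast bA
        = Set.univ ∧
      g.domainOfDependence A ∩ g.domainOfDependence Ac = ∅ ∧
      g.domainOfDependence A ∩ g.causalFuture bA = ∅ ∧
      g.domainOfDependence A ∩ g.causalPast bA = ∅ ∧
      g.domainOfDependence Ac ∩ g.causalFuture bA = ∅ ∧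
      g.domainOfDependence Ac ∩ g.causalPast bA = ∅ ∧
      g.causalFuture bA ∩ g.causalPast bA = bA := by
  replace hg := hg.1
  have hac := hS.2.1
  obtain ⟨V, hV, hAV⟩ : ∃ V, IsOpen V ∧ A = S ∩ V :=
    hA ▸ exists_isOpen_image_val_eq_inter isOpen_interior
  obtain ⟨V', hV', hAcV'⟩ : ∃ V', IsOpen V' ∧ Ac = S ∩ V' := by
    obtain ⟨V', hV', h⟩ := exists_isOpen_image_val_eq_inter
      (isClosed_closure (s := (Subtype.val : S → B) ⁻¹' N)).isOpen_compl
    refine ⟨V', hV', ?_⟩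
    rw [← h, Set.image_val_compl, closure_eq_interior_union_frontier, Set.image_union, hAc, hA, hbA,
      relInterior, relBoundary]
  have hAS : A ⊆ S := hAV ▸ Set.inter_subset_left
  have hAcS : Ac ⊆ S := hAcV' ▸ Set.inter_subset_left
  have hbS : bA ⊆ S := by
    rw [hbA]
    rintro _ ⟨x, -, rfl⟩
    exact x.2
  have hAb : Disjoint A bA := by
    rw [hA, hbA]
    exact (Set.disjoint_image_iff Subtype.val_injective).2 disjoint_interior_frontier
  have hAAc : Disjoint A Ac := by
    rw [hAc]
    exact Set.disjoint_sdiff_right.mono_left Set.subset_union_left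
  have hAcb : Disjoint Ac bA := by
    rw [hAc]
    exact Set.disjoint_sdiff_left.mono_right Set.subset_union_right
  have hrel : ∀ X ⊆ S, Disjoint X bA → g.domainOfDependence X ∩ g.causalFuture bA = ∅ ∧
      g.domainOfDependence X ∩ g.causalPast bA = ∅ := by
    intro X hX hXb
    refine ⟨Set.eq_empty_of_forall_notMem ?_, Set.eq_empty_of_forall_notMem ?_⟩
    · rintro p ⟨hp, b, hb, h⟩
      exact Spacetime.not_related_of_mem_domainOfDependence hg hac hX hbS hXb hp hb
        (h.imp Eq.symm Or.inl)
    · rintro p ⟨hp, b, hb, h⟩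
      exact Spacetime.not_related_of_mem_domainOfDependence hg hac hX hbS hXb hp hb
        (h.imp Eq.symm Or.inr)
  refine ⟨Set.eq_univ_of_forall fun p ↦ ?_, Set.eq_empty_of_forall_notMem ?_, (hrel A hAS hAb).1,
    (hrel A hAS hAb).2, (hrel Ac hAcS hAcb).1, (hrel Ac hAcS hAcb).2, ?_⟩
  · by_contra hp
    simp only [Set.mem_union, not_or] at hp
    obtain ⟨⟨⟨hpA, hpAc⟩, hpf⟩, hpp⟩ := hp
    have hb : ∀ b ∈ bA, ¬ (p = b ∨ g.CausallyPrecedes b p ∨ g.CausallyPrecedes p b) := by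
      rintro b hb (rfl | h | h)
      · exact hpf ⟨p, hb, Or.inl rfl⟩
      · exact hpf ⟨b, hb, Or.inr h⟩
      · exact hpp ⟨b, hb, Or.inr h⟩
    have hcover : ∀ y ∈ S, y ∉ A → y ∉ Ac → y ∈ bA := by
      intro y hy hyA hyAc
      by_contra hyb
      exact hyAc (hAc ▸ ⟨hy, fun h ↦ h.elim hyA hyb⟩)
    have hbp : ∀ y ∈ S, y ∉ V → y ∉ V' → ¬ g.CausallyPrecedes y p ∧ ¬ g.CausallyPrecedes p y := by
      intro y hy hyV hyV'
      have hyb := hcover y hy (fun h ↦ hyV (hAV ▸ h).2) (fun h ↦ hyV' (hAcV' ▸ h).2)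
      exact ⟨fun h ↦ hb y hyb (Or.inr (Or.inl h)), fun h ↦ hb y hyb (Or.inr (Or.inr h))⟩
    have hVV' : Disjoint (S ∩ V) (S ∩ V') := hAV ▸ hAcV' ▸ hAAc
    obtain ⟨q₁, ⟨hq₁S, hq₁A⟩, hq₁⟩ := Spacetime.exists_of_notMem_domainOfDependence hS.2.2 hpA
    obtain ⟨q₂, ⟨hq₂S, hq₂Ac⟩, hq₂⟩ := Spacetime.exists_of_notMem_domainOfDependence hS.2.2 hpAc
    have hq₁Ac : q₁ ∈ Ac := by
      by_contra h
      exact hb q₁ (hcover q₁ hq₁S hq₁A h) hq₁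
    have hq₂A : q₂ ∈ A := by
      by_contra h
      exact hb q₂ (hcover q₂ hq₂S h hq₂Ac) hq₂
    obtain ⟨t₁, y₁, hy₁, h₁⟩ := hS.exists_flowsTo_of_related hg hV' hV hVV'.symm
      (hAcV' ▸ hq₁Ac) hq₁ fun y hy hyV' hyV ↦ hbp y hy hyV hyV'
    obtain ⟨t₂, y₂, hy₂, h₂⟩ := hS.exists_flowsTo_of_related hg hV hV' hVV' (hAV ▸ hq₂A) hq₂ hbp
    have heq := hac.eq_of_flowsTo hg hy₁.1 hy₂.1 h₁ h₂
    exact Set.disjoint_left.1 hVV' hy₂ (heq ▸ hy₁)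
  · rintro p ⟨hpA, hpAc⟩
    obtain ⟨t, q, hq, h⟩ := Spacetime.exists_of_mem_domainOfDependence hg hpAc
    refine Spacetime.not_related_of_mem_domainOfDependence hg hac hAS hAcS hAAc hpA hq ?_
    rcases lt_trichotomy t 0 with ht | rfl | ht
    · exact Or.inr (Or.inl (h.symm.causallyPrecedes (neg_pos.2 ht)))
    · exact Or.inl (h.eq_of_time_zero)
    · exact Or.inr (Or.inr (h.causallyPrecedes ht))
  · refine Set.Subset.antisymm ?_ fun p hp ↦ ⟨⟨p, hp, Or.inl rfl⟩, ⟨p, hp, Or.inl rfl⟩⟩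
    rintro p ⟨⟨b, hb, rfl | h⟩, b', hb', rfl | h'⟩
    · exact hb
    · exact hb
    · exact hb'
    · exact absurd (h.trans h') (hac.not_causallyPrecedes hg (hbS hb) (hbS hb'))
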